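/- Throughout, functions are real-valued, integrals over $\mathbb{R}$ are with respect to Lebesgue measure, $|E|$ is the Lebesgue measure of $E$, $\upsilon(Q):=\int_Q\upsilon(x)\,dx$, and in $[0,\infty]$ we use $0\cdot\infty=0$ and $0^{-s}=\infty$ for $s>0$. **Definitions.** Let $\upsilon\ge 0$ be a locally integrable function on $\mathbb{R}$ and $p\in[1,\infty)$. We write $\upsilon\in A_p(\mathbb{R})$ if $$\sup_{Q}\Big[\frac1{|Q|}\int_Q\upsilon\,dx\Big]\Big[\frac1{|Q|}\int_Q\upsilon^{1-p'}dx\Big]^{p-1}<\infty\ \ (p>1,\ \tfrac1p+\tfrac1{p'}=1),\qquad \sup_{Q}\Big[\frac1{|Q|}\int_Q\upsilon\,dx\Big]\|\upsilon^{-1}\|_{L^\infty(Q)}<\infty\ \ (p=1),$$ the suprema being over all bounded nondegenerate intervals $Q\subset\mathbb{R}$. For $k\in\mathbb{N}=\{1,2,\dots\}$, $\dot W^{k,p}_\upsilon(\mathbb{R})$ is the set of all $f\in L^1_{\rm loc}(\mathbb{R})$ having a $k$-th weak derivative $f^{(k)}\in L^1_{\rm loc}(\mathbb{R})$ with $\int_{\mathbb{R}}|f^{(k)}|^p\upsilon\,dx<\infty$.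 For $x,h\in\mathbb{R}$ let $\Delta_h^kf(x):=\sum_{j=0}^k(-1)^{k-j}\binom kj f(x+jh)$ and, for $\lambda\in(0,\infty)$ and $b\in\mathbb{R}$, $$E_{\lambda,b,k}[f]:=\{(x,h)\in\mathbb{R}\times(\mathbb{R}\setminus\{0\}):\ |\Delta_h^kf(x)|>\lambda|h|^{k+b}\}.$$ For $q\in(0,\infty)$ let $\Gamma_{1,q}:=(-\infty,-q)\cup(0,\infty)$ and $\Gamma_{p,q}:=\mathbb{R}\setminus\{0\}$ if $p>1$. For $\alpha\in\{0,\frac13,\frac23\}$ let $\mathcal{D}^\alpha:=\{2^j[m+[0,1)+(-1)^j\alpha]:\ j,m\in\mathbb{Z}\}$. For a bounded nondegenerate interval $Q$ let $P_Q^{(k-1)}(f)$ be the unique polynomial of degree at most $k-1$ such that $\int_Q[f(x)-P_Q^{(k-1)}(f)(x)]x^i\,dx=0$ for $i=0,\dots,k-1$, let $E_k(f,Q):=\|f-P_Q^{(k-1)}(f)\|_{L^1(Q)}$, and, for $\beta\in\mathbb{R}$ and $\lambda\in(0,\infty)$, let $\mathcal{D}^\alpha_{\lambda,\beta,k}[f]:=\{Q\in\mathcal{D}^\alpha:\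 E_k(f,Q)>\lambda|Q|^{\beta+k}\}$. **Corollary 3.5.** Let $\upsilon\in L^1_{\rm loc}(\mathbb{R})$ be nonnegative, $k\in\mathbb{N}$, $p\in[1,\infty)$, and let $q\in(0,\infty)$ satisfy $1-\frac1q<k$. Then the following three statements are mutually equivalent. (i) $\upsilon\in A_p(\mathbb{R})$. (ii) There exist $\gamma\in\Gamma_{p,q}$ and $C\in(0,\infty)$ such that, for any $f\in\dot W^{k,p}_\upsilon(\mathbb{R})$, $$\sup_{\lambda\in(0,\infty)}\lambda^p\int_{\mathbb{R}}\Big[\int_{\mathbb{R}}\mathbf 1_{E_{\lambda,\gamma/q,k}[f]}(x,h)\,|h|^{\gamma-1}\,dh\Big]^{p/q}\upsilon(x)\,dx\le C\int_{\mathbb{R}}|f^{(k)}(x)|^p\upsilon(x)\,dx.$$ (iii) There exist $C\in(0,\infty)$ and $\beta$, with $\beta\in(-\infty,0)\cup(1,\infty)$ if $p=1$ and $\beta\in\mathbb{R}\setminus\{1\}$ if $p>1$, such that, for any $\alpha\in\{0,\frac13,\frac23\}$ and any $f\in\dot W^{k,p}_\upsilon(\mathbb{R})$, $$\sup_{\lambda\in(0,\infty)}\lambda^p\sum_{Q\in\mathcal{D}^\alpha_{\lambda,\beta,k}[f]}|Q|^{p(\beta-1)}\upsilon(Q)\le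 C\int_{\mathbb{R}}|f^{(k)}(x)|^p\upsilon(x)\,dx.$$ -/

import Mathlib

open MeasureTheory Set
open scoped ENNReal

namespace BSVY

noncomputable section

/-! ### Muckenhoupt weights on the line -/

/-- The Muckenhoupt constant `[υ]_{A_p}`, `1 ≤ p < ∞`, of a nonnegative weight `υ` on `ℝ`: the
supremum over all bounded nondegenerate intervals `Q` of
`(⨍_Q υ) (⨍_Q υ ^ (1 - p')) ^ (p - 1)` if `p > 1`, and of `(⨍_Q υ) ‖υ⁻¹‖_{L^∞(Q)}` if `p = 1`.
All quantities live in `[0, ∞]`: a negative power of `0` is `∞`, and `0 * ∞ = 0`. -/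
def apConst (p : ℝ) (υ : ℝ → ℝ) : ℝ≥0∞ :=
  ⨆ (a : ℝ) (b : ℝ) (_ : a < b),
    if p = 1 then
      (⨍⁻ x in Icc a b, ENNReal.ofReal (υ x) ∂volume) *
        essSup (fun x => (ENNReal.ofReal (υ x))⁻¹) (volume.restrict (Icc a b))
    else
      (⨍⁻ x in Icc a b, ENNReal.ofReal (υ x) ∂volume) *
        (⨍⁻ x in Icc a b, ENNReal.ofReal (υ x) ^ (1 - Real.conjExponent p) ∂volume) ^ (p - 1)

/-- `υ ∈ A_p(ℝ)`. -/
def IsAp (p : ℝ) (υ : ℝ → ℝ) : Prop :=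
  (∀ x, 0 ≤ υ x) ∧ LocallyIntegrable υ volume ∧ apConst p υ < ∞

/-! ### Homogeneous weighted Sobolev spaces -/

/-- `g ∈ L¹_loc(ℝ)` is the `k`-th weak derivative of `f`. -/
def IsWeakDeriv (k : ℕ) (f g : ℝ → ℝ) : Prop :=
  LocallyIntegrable g volume ∧
    ∀ φ : ℝ → ℝ, ContDiff ℝ (⊤ : ℕ∞) φ → HasCompactSupport φ →
      ∫ x, f x * iteratedDeriv k φ x = (-1) ^ k * ∫ x, g x * φ x

/-- `∫ |g|^p υ`, that is, the `p`-th power of the `L^p_υ`-norm of `g`. -/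
def weightedEnergy (p : ℝ) (υ g : ℝ → ℝ) : ℝ≥0∞ :=
  ∫⁻ x, ‖g x‖ₑ ^ p * ENNReal.ofReal (υ x)

/-- `f` belongs to the homogeneous weighted Sobolev space `Ẇ^{k,p}_υ(ℝ)`. -/
def MemHomSobolev (k : ℕ) (p : ℝ) (υ f : ℝ → ℝ) : Prop :=
  LocallyIntegrable f volume ∧ ∃ g, IsWeakDeriv k f g ∧ weightedEnergy p υ g < ∞

/-! ### Differences and level sets -/

/-- The `k`-th order difference `Δ_h^k f (x)`. -/
def diff (k : ℕ) (h : ℝ) (f : ℝ → ℝ) (x : ℝ) : ℝ :=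
  ∑ j ∈ Finset.range (k + 1), (-1) ^ (k - j) * (k.choose j : ℝ) * f (x + j * h)

/-- The explicit difference is Mathlib's iterated forward difference. -/
theorem diff_eq_fwdDiff (k : ℕ) (h : ℝ) (f : ℝ → ℝ) (x : ℝ) :
    diff k h f x = (fwdDiff h)^[k] f x := by
  rw [fwdDiff_iter_eq_sum_shift, diff]
  refine Finset.sum_congr rfl fun j _ => ?_
  simp

/-- The level set `E_{t,b,k}[f]` of all `(x,h)`, `h ≠ 0`, with `|Δ_h^k f(x)| > t |h|^{k+b}`. -/
def levelSet (t b : ℝ) (k : ℕ) (f : ℝ → ℝ) : Set (ℝ × ℝ) :=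
  {z | z.2 ≠ 0 ∧ t * |z.2| ^ ((k : ℝ) + b) < |diff k z.2 f z.1|}

/-- The set `Γ_{p,q}` of admissible exponents `γ`. -/
def admissibleGamma (p q : ℝ) : Set ℝ :=
  if p = 1 then Iio (-q) ∪ Ioi 0 else {0}ᶜ

/-- `sup_{t>0} t^p ∫ [∫ 1_{E_{t,γ/q,k}[f]}(x,h) |h|^{γ-1} dh]^{p/q} υ(x) dx`. -/
def bsvyFunctional (k : ℕ) (p q γ : ℝ) (υ f : ℝ → ℝ) : ℝ≥0∞ :=
  ⨆ (t : ℝ) (_ : 0 < t),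
    ENNReal.ofReal (t ^ p) *
      ∫⁻ x, (∫⁻ h, (levelSet t (γ / q) k f).indicator
          (fun z => ENNReal.ofReal (|z.2| ^ (γ - 1))) (x, h)) ^ (p / q) *
        ENNReal.ofReal (υ x)

/-! ### Local polynomial approximation -/

/-- `P` is a polynomial of degree at most `s` such that `f - P` is orthogonal on `Q` to all
monomials of degree at most `s`. -/
def IsMinPoly (s : ℕ) (f : ℝ → ℝ) (Q : Set ℝ) (P : Polynomial ℝ) : Prop :=
  P.natDegree ≤ s ∧ ∀ i ≤ s, ∫ x in Q, (f x - P.eval x) * x ^ i = 0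

theorem integrableOn_poly (P : Polynomial ℝ) (a b : ℝ) :
    IntegrableOn (fun x => P.eval x) (Ico a b) volume :=
  (P.continuous.integrableOn_Icc (a := a) (b := b)).mono_set Ico_subset_Icc_self

theorem integrableOn_poly_mul_pow (P : Polynomial ℝ) (i : ℕ) (a b : ℝ) :
    IntegrableOn (fun x => P.eval x * x ^ i) (Ico a b) volume := by
  have h := integrableOn_poly (P * Polynomial.X ^ i) a b
  have e : (fun x => (P * Polynomial.X ^ i).eval x) = fun x : ℝ => P.eval x * x ^ i := by
    funext x
    rw [Polynomial.eval_mul, Polynomial.eval_pow, Polynomial.eval_X]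
  rwa [e] at h

theorem poly_eq_zero_of_moments {s : ℕ} {a b : ℝ} (hab : a < b) {P : Polynomial ℝ}
    (hP : P.natDegree ≤ s) (h : ∀ i ≤ s, ∫ x in Ico a b, P.eval x * x ^ i = 0) : P = 0 := by
  have hsq : ∫ x in Ico a b, P.eval x * P.eval x = 0 := by
    have e : (fun x : ℝ => P.eval x * P.eval x) =
        fun x => ∑ i ∈ Finset.range (P.natDegree + 1), P.coeff i * (P.eval x * x ^ i) := by
      funext x
      conv_lhs => rw [show P.eval x * P.eval x = P.eval x *
        ∑ i ∈ Finset.range (P.natDegree + 1), P.coeff i * x ^ i by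
          rw [← Polynomial.eval_eq_sum_range]]
      rw [Finset.mul_sum]
      exact Finset.sum_congr rfl fun i _ => by ring
    rw [e, integral_finsetSum]
    · refine Finset.sum_eq_zero fun i hi => ?_
      rw [integral_const_mul, h i (by have := Finset.mem_range.1 hi; omega), mul_zero]
    · intro i _
      refine Integrable.const_mul ?_ _
      exact integrableOn_poly_mul_pow P i a b
  have hint : IntegrableOn (fun x => P.eval x * P.eval x) (Ico a b) volume := by
    simpa using integrableOn_poly (P * P) a b
  have h0 := (setIntegral_eq_zero_iff_of_nonneg_ae
    (Filter.Eventually.of_forall fun x => mul_self_nonneg (P.eval x)) hint).1 hsq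
  by_contra hne
  have hfin : volume {x : ℝ | P.IsRoot x} = 0 :=
    (Polynomial.finite_setOfPred_isRoot hne).measure_zero _
  have hvol : volume (Ico a b) = 0 := by
    rw [Filter.EventuallyEq, ae_restrict_iff' measurableSet_Ico] at h0
    refine measure_mono_null (t := {x : ℝ | P.IsRoot x} ∪
      {x | ¬ (x ∈ Ico a b → P.eval x * P.eval x = (0 : ℝ → ℝ) x)}) ?_
      (measure_union_null hfin h0)
    intro x hx
    by_cases hr : P.IsRoot x
    · exact Or.inl hr
    · right
      intro hc
      exact hr (mul_self_eq_zero.1 (hc hx))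
  rw [Real.volume_Ico, ENNReal.ofReal_eq_zero] at hvol
  linarith

/-- On a bounded nondegenerate interval, a locally integrable function has exactly one
minimizing polynomial. -/
theorem existsUnique_isMinPoly (s : ℕ) {f : ℝ → ℝ} (hf : LocallyIntegrable f volume)
    {a b : ℝ} (hab : a < b) : ∃! P, IsMinPoly s f (Ico a b) P := by
  have hfi : ∀ i : ℕ, IntegrableOn (fun x => f x * x ^ i) (Ico a b) volume := fun i =>
    ((hf.integrableOn_isCompact isCompact_Icc).mul_continuousOn (by fun_prop)
      isCompact_Icc).mono_set Ico_subset_Icc_self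
  have hpi : ∀ (P : Polynomial ℝ) (i : ℕ),
      IntegrableOn (fun x => P.eval x * x ^ i) (Ico a b) volume := fun P i => by
    exact integrableOn_poly_mul_pow P i a b
  have hsub : ∀ (P : Polynomial ℝ) (i : ℕ), ∫ x in Ico a b, (f x - P.eval x) * x ^ i =
      (∫ x in Ico a b, f x * x ^ i) - ∫ x in Ico a b, P.eval x * x ^ i := fun P i => by
    rw [← integral_sub (hfi i) (hpi P i)]
    exact integral_congr_ae (Filter.Eventually.of_forall fun x => by ring)
  let L : Polynomial.degreeLT ℝ (s + 1) →ₗ[ℝ] (Fin (s + 1) → ℝ) :=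
    { toFun := fun P i => ∫ x in Ico a b, (P : Polynomial ℝ).eval x * x ^ (i : ℕ)
      map_add' := fun P R => by
        funext i
        simp only [Submodule.coe_add, Polynomial.eval_add, Pi.add_apply]
        rw [← integral_add (hpi P i) (hpi R i)]
        exact integral_congr_ae (Filter.Eventually.of_forall fun x => by ring)
      map_smul' := fun c P => by
        funext i
        simp only [Submodule.coe_smul, Polynomial.eval_smul, smul_eq_mul, Pi.smul_apply,
          RingHom.id_apply]
        rw [← integral_const_mul]
        exact integral_congr_ae (Filter.Eventually.of_forall fun x => by ring) }
  have hdeg : ∀ P : Polynomial ℝ, P ∈ Polynomial.degreeLT ℝ (s + 1) ↔ P.natDegree ≤ s := by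
    intro P
    rw [Polynomial.mem_degreeLT, Polynomial.natDegree_le_iff_degree_le]
    exact_mod_cast Order.lt_succ_iff (a := P.degree) (b := (s : WithBot ℕ))
  have hinj : Function.Injective L := by
    rw [injective_iff_map_eq_zero]
    intro P hP
    apply Subtype.ext
    refine poly_eq_zero_of_moments hab ((hdeg P).1 P.2) fun i hi => ?_
    exact congrFun hP ⟨i, by omega⟩
  have hsurj : Function.Surjective L := by
    refine (LinearMap.injective_iff_surjective_of_finrank_eq_finrank ?_).1 hinj
    rw [(Polynomial.degreeLTEquiv ℝ (s + 1)).finrank_eq]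
  obtain ⟨P, hP⟩ := hsurj fun i => ∫ x in Ico a b, f x * x ^ (i : ℕ)
  refine ⟨P, ⟨(hdeg P).1 P.2, fun i hi => ?_⟩, fun R hR => ?_⟩
  · rw [hsub, ← congrFun hP ⟨i, by omega⟩]
    exact sub_self _
  · have hRm : R ∈ Polynomial.degreeLT ℝ (s + 1) := (hdeg R).2 hR.1
    have : (⟨R, hRm⟩ : Polynomial.degreeLT ℝ (s + 1)) = P := by
      apply hinj
      rw [hP]
      funext i
      have := hR.2 i (by have := i.2; omega)
      rw [hsub] at this
      exact (sub_eq_zero.1 this).symm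
    exact congrArg Subtype.val this

open Classical in
/-- The minimizing polynomial `P_Q^{(s)}(f)`. By `existsUnique_isMinPoly` the first branch applies,
with a unique choice, to all locally integrable `f` and all intervals `Q = [a,b)`, `a < b`. -/
def minPoly (s : ℕ) (f : ℝ → ℝ) (Q : Set ℝ) : Polynomial ℝ :=
  if h : ∃ P, IsMinPoly s f Q P then h.choose else 0

/-- The defining property of the minimizing polynomial. -/
theorem minPoly_spec (s : ℕ) {f : ℝ → ℝ} (hf : LocallyIntegrable f volume)
    {a b : ℝ} (hab : a < b) : IsMinPoly s f (Ico a b) (minPoly s f (Ico a b)) := by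
  have h := (existsUnique_isMinPoly s hf hab).exists
  rw [minPoly, dif_pos h]
  exact h.choose_spec

/-- The local approximation `E_k(f,Q) = ‖f - P_Q^{(k-1)}(f)‖_{L¹(Q)}` (used for `k ≥ 1`). -/
def localApprox (k : ℕ) (f : ℝ → ℝ) (Q : Set ℝ) : ℝ≥0∞ :=
  ∫⁻ x in Q, ‖f x - (minPoly (k - 1) f Q).eval x‖ₑ

/-! ### Dyadic intervals -/

/-- The shifted dyadic grid `𝒟^α` of all intervals `2^j (m + [0,1) + (-1)^j α)`, `j, m ∈ ℤ`. -/
def dyadicGrid (α : ℝ) : Set (Set ℝ) :=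
  {Q | ∃ j m : ℤ, Q = Ico ((2 : ℝ) ^ j * (m + (-1 : ℝ) ^ j * α))
    ((2 : ℝ) ^ j * (m + 1 + (-1 : ℝ) ^ j * α))}

/-- The intervals `Q` of `𝒟^α` with `E_k(f,Q) > t |Q|^{β+k}`. -/
def dyadicLevel (α t β : ℝ) (k : ℕ) (f : ℝ → ℝ) : Set (Set ℝ) :=
  {Q | Q ∈ dyadicGrid α ∧
    ENNReal.ofReal t * volume Q ^ (β + (k : ℝ)) < localApprox k f Q}

/-- The set of admissible exponents `β`. -/
def admissibleBeta (p : ℝ) : Set ℝ :=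
  if p = 1 then Iio 0 ∪ Ioi 1 else {1}ᶜ

/-- `sup_{t>0} t^p ∑_Q |Q|^{p(β-1)} υ(Q)`, the sum over all `Q ∈ 𝒟^α` with
`E_k(f,Q) > t |Q|^{β+k}`. -/
def dyadicFunctional (k : ℕ) (p β α : ℝ) (υ f : ℝ → ℝ) : ℝ≥0∞ :=
  ⨆ (t : ℝ) (_ : 0 < t),
    ENNReal.ofReal (t ^ p) *
      ∑' Q : dyadicLevel α t β k f,
        volume (Q : Set ℝ) ^ (p * (β - 1)) * ∫⁻ x in (Q : Set ℝ), ENNReal.ofReal (υ x)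

end

end BSVY

namespace BSVY

noncomputable section

/-! ### Iterated primitives and weak derivatives -/

/-! The Muckenhoupt condition is used in one form only: intervals satisfy (∫_Q |g|)^p υ(Q) ≤ K |Q|^p
∫_Q |g|^p υ. Hölder's inequality derives this from A_p (`IsAp.avgBound`). Conversely, testing it
with powers of υ, or with sublevel sets of υ when p = 1, gives A_p back (`TestAvgBound.isAp`).

Sufficiency needs one admissible exponent: γ = q, so that γ/q = 1, and β = 2. Write g for the k-th
weak derivative. By Taylor's formula the k-th difference is at most |h|^(k-1) ∫_{B(x,k|h|)} |g|, and
the local approximation on Q is at most |Q|^k ∫_Q |g|. Hence a point of the level set, or an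
interval of the dyadic level family, produces a heavy ball: one with ∫_B |g| > c t r². Both
functionals are then dominated by t^p ∫ M^p υ, where M(x) is the largest radius of a heavy ball
containing x: integrating |h|^(q-1) over |h| ≤ M and raising to the power p/q gives a multiple of
M^p, and so does the geometric sum of |Q|^p over the level intervals containing x. A Vitali
covering, together with the averaging inequality on the fivefold enlargements of the selected balls,
bounds t^p ∫ M^p υ by the energy (`AvgBound.maxRadius_heavyBalls`).

Necessity works for every exponent. For bounded g ≥ 0 supported in an interval I of length ℓ, let f
be the k-fold primitive of g. If I lies well inside Q, the approximation error of f on Q is at least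
c |Q|^k ∫ g (`exists_le_localApprox`). If x lies in I ∓ 2ℓ and ±h is between 3ℓ and 4ℓ, the k-th
difference is at least c ℓ^(k-1) ∫ g in absolute value (`diff_prim_ge`). A level t just below these
bounds makes the exponent γ or β cancel by homogeneity, leaving the averaging inequality. In the
dyadic case the one-third trick supplies Q. In the other case the weight sits on a translate of I,
and a second test with the indicator of that translate brings it back to I. -/

/-- The `k`-fold primitive of `g` based at `a`. -/
def prim (a : ℝ) : ℕ → (ℝ → ℝ) → ℝ → ℝ
  | 0, g => g
  | k + 1, g => fun x => ∫ t in a..x, prim a k g t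

theorem intervalIntegrable_of_locallyIntegrable {u : ℝ → ℝ} (hu : LocallyIntegrable u volume)
    (a b : ℝ) : IntervalIntegrable u volume a b :=
  (hu.integrableOn_isCompact isCompact_uIcc).intervalIntegrable

theorem continuous_primitive_of_locallyIntegrable {u : ℝ → ℝ} (hu : LocallyIntegrable u volume)
    (a : ℝ) : Continuous fun x => ∫ t in a..x, u t :=
  intervalIntegral.continuous_primitive (intervalIntegrable_of_locallyIntegrable hu) a

theorem prim_locallyIntegrable {g : ℝ → ℝ} (hg : LocallyIntegrable g volume) (a : ℝ) (k : ℕ) :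
    LocallyIntegrable (prim a k g) volume := by
  induction k with
  | zero => exact hg
  | succ k ih => exact (continuous_primitive_of_locallyIntegrable ih a).locallyIntegrable

theorem prim_continuous {g : ℝ → ℝ} (hg : LocallyIntegrable g volume) (a : ℝ) (k : ℕ) :
    Continuous (prim a (k + 1) g) :=
  continuous_primitive_of_locallyIntegrable (prim_locallyIntegrable hg a k) a

theorem exists_Ioo_of_hasCompactSupport {φ : ℝ → ℝ} (hφ : HasCompactSupport φ) :
    ∃ R : ℝ, 0 < R ∧ tsupport φ ⊆ Ioo (-R) R := by
  obtain ⟨R, hR0, hR⟩ := hφ.isCompact.isBounded.subset_ball_lt 0 0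
  exact ⟨R, hR0, by simpa [Real.ball_eq_Ioo] using hR⟩

theorem integral_eq_intervalIntegral_of_support {u φ : ℝ → ℝ} {R : ℝ}
    (h : tsupport φ ⊆ Ioo (-R) R) : ∫ x, u x * φ x = ∫ x in (-R)..R, u x * φ x := by
  symm
  apply intervalIntegral.integral_eq_integral_of_support_subset
  intro x hx
  have : x ∈ Ioo (-R) R := h (subset_tsupport _ (right_ne_zero_of_mul hx))
  exact ⟨this.1, this.2.le⟩

/-- Integration by parts for the primitive of a locally integrable function. -/
theorem integral_primitive_mul_deriv {u : ℝ → ℝ} (hu : LocallyIntegrable u volume) (a : ℝ)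
    {φ : ℝ → ℝ} (hφ : ContDiff ℝ 1 φ) (hc : HasCompactSupport φ) :
    ∫ x, (∫ t in a..x, u t) * deriv φ x = -∫ x, u x * φ x := by
  obtain ⟨R, hR0, hR⟩ := exists_Ioo_of_hasCompactSupport hc
  have hR' : tsupport (deriv φ) ⊆ Ioo (-R) R := (tsupport_deriv_subset (f := φ)).trans hR
  rw [integral_eq_intervalIntegral_of_support hR', integral_eq_intervalIntegral_of_support hR]
  set M := max R |a|
  have hu' := intervalIntegrable_of_locallyIntegrable hu
  have hsub : uIcc (-R) R ⊆ uIcc (-M) M := by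
    have h1 : R ≤ M := le_max_left _ _
    rw [uIcc_of_le (by linarith), uIcc_of_le (by linarith)]
    exact Icc_subset_Icc (by linarith) h1
  have haM : a ∈ uIcc (-M) M := by
    have h1 : R ≤ M := le_max_left _ _
    have h2 : |a| ≤ M := le_max_right _ _
    rw [uIcc_of_le (by linarith)]
    exact abs_le.1 h2
  have hF : AbsolutelyContinuousOnInterval (fun x => ∫ t in a..x, u t) (-R) R :=
    ((hu' (-M) M).absolutelyContinuousOnInterval_intervalIntegral haM).mono hsub
  have hG : AbsolutelyContinuousOnInterval φ (-R) R :=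
    hφ.contDiffOn.absolutelyContinuousOnInterval
  rw [hF.integral_mul_deriv_eq_deriv_mul hG]
  have z1 : φ R = 0 := image_eq_zero_of_notMem_tsupport fun h => lt_irrefl _ (hR h).2
  have z2 : φ (-R) = 0 := image_eq_zero_of_notMem_tsupport fun h => lt_irrefl _ (hR h).1
  rw [z1, z2, mul_zero, mul_zero, sub_zero, zero_sub]
  congr 1
  apply intervalIntegral.integral_congr_ae
  filter_upwards [LocallyIntegrable.ae_hasDerivAt_integral hu] with x hx _
  rw [(hx a).deriv]

theorem contDiff_iteratedDeriv_top {φ : ℝ → ℝ} (hφ : ContDiff ℝ (⊤ : ℕ∞) φ) (k : ℕ) :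
    ContDiff ℝ (⊤ : ℕ∞) (iteratedDeriv k φ) :=
  hφ.iterate_deriv k |> fun h => by rwa [iteratedDeriv_eq_iterate]

theorem hasCompactSupport_iteratedDeriv {φ : ℝ → ℝ} (hφ : HasCompactSupport φ) (k : ℕ) :
    HasCompactSupport (iteratedDeriv k φ) := by
  induction k with
  | zero => simpa using hφ
  | succ k ih => rw [iteratedDeriv_succ]; exact ih.deriv

theorem tsupport_iteratedDeriv_subset {φ : ℝ → ℝ} (k : ℕ) :
    tsupport (iteratedDeriv k φ) ⊆ tsupport φ := by
  induction k with
  | zero => simp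
  | succ k ih => rw [iteratedDeriv_succ]; exact (tsupport_deriv_subset).trans ih

theorem prim_isWeakDeriv {g : ℝ → ℝ} (hg : LocallyIntegrable g volume) (a : ℝ) (k : ℕ) :
    IsWeakDeriv k (prim a k g) g := by
  refine ⟨hg, ?_⟩
  induction k with
  | zero => intro φ _ _; simp [prim]
  | succ k ih =>
    intro φ hφ hc
    rw [iteratedDeriv_succ]
    have := integral_primitive_mul_deriv (prim_locallyIntegrable hg a k) a
      ((contDiff_iteratedDeriv_top hφ k).of_le (by exact_mod_cast le_top))
      (hasCompactSupport_iteratedDeriv hc k)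
    change ∫ x, (∫ t in a..x, prim a k g t) * deriv (iteratedDeriv k φ) x = _
    rw [this, ih φ hφ hc]
    ring

theorem poly_isWeakDeriv (P : Polynomial ℝ) (k : ℕ) :
    IsWeakDeriv k (fun x => P.eval x) fun x => ((Polynomial.derivative^[k]) P).eval x := by
  refine ⟨(Polynomial.continuous _).locallyIntegrable, ?_⟩
  induction k generalizing P with
  | zero => intro φ _ _; simp
  | succ k ih =>
    intro φ hφ hc
    have h1 : ∀ x, P.eval x = P.eval 0 + ∫ t in (0 : ℝ)..x, (Polynomial.derivative P).eval t := by
      intro x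
      rw [intervalIntegral.integral_eq_sub_of_hasDerivAt (fun t _ => P.hasDerivAt t)
        ((Polynomial.continuous _).intervalIntegrable _ _)]
      ring
    have hψ := (contDiff_iteratedDeriv_top hφ k).of_le
      (show (1 : WithTop ℕ∞) ≤ _ by exact_mod_cast le_top)
    have hψc := hasCompactSupport_iteratedDeriv hc k
    have hlp : LocallyIntegrable (fun t => (Polynomial.derivative P).eval t) volume :=
      (Polynomial.continuous _).locallyIntegrable
    have h2 := integral_primitive_mul_deriv hlp 0 hψ hψc
    have h3 := integral_primitive_mul_deriv (u := fun _ => 0) locallyIntegrable_zero 0 hψ hψc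
    have h4 : ∫ x, deriv (iteratedDeriv k φ) x = 0 :=
      integral_eq_zero_of_hasDerivAt_of_integrable
        (fun x => (hψ.differentiable (by norm_num) x).hasDerivAt)
        ((hψ.continuous_deriv le_rfl).integrable_of_hasCompactSupport hψc.deriv)
        (hψ.continuous.integrable_of_hasCompactSupport hψc)
    rw [iteratedDeriv_succ]
    have hci : ∀ u : ℝ → ℝ, Continuous u →
        Integrable (fun x => u x * deriv (iteratedDeriv k φ) x) volume := fun u hu =>
      (hu.mul (hψ.continuous_deriv le_rfl)).integrable_of_hasCompactSupport hψc.deriv.mul_left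
    have : ∫ x, P.eval x * deriv (iteratedDeriv k φ) x =
        -∫ x, (Polynomial.derivative P).eval x * iteratedDeriv k φ x := by
      rw [← h2]
      have e : ∀ x, P.eval x * deriv (iteratedDeriv k φ) x =
          P.eval 0 * deriv (iteratedDeriv k φ) x +
          (∫ t in (0 : ℝ)..x, (Polynomial.derivative P).eval t) *
            deriv (iteratedDeriv k φ) x := fun x => by rw [← add_mul, ← h1 x]
      simp_rw [e]
      rw [integral_add (hci _ continuous_const)
        (hci _ (continuous_primitive_of_locallyIntegrable hlp 0)), integral_const_mul, h4,
        mul_zero, zero_add]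
    rw [this, ih (Polynomial.derivative P) φ hφ hc, Function.iterate_succ_apply]
    ring

theorem integrable_mul_of_hasCompactSupport {u φ : ℝ → ℝ} (hu : LocallyIntegrable u volume)
    (hφ : Continuous φ) (hc : HasCompactSupport φ) : Integrable (fun x => u x * φ x) volume := by
  simpa [smul_eq_mul, mul_comm] using hu.integrable_smul_left_of_hasCompactSupport hφ hc

theorem IsWeakDeriv.sub {k : ℕ} {f₁ f₂ g₁ g₂ : ℝ → ℝ} (hf₁ : LocallyIntegrable f₁ volume)
    (hf₂ : LocallyIntegrable f₂ volume) (h₁ : IsWeakDeriv k f₁ g₁) (h₂ : IsWeakDeriv k f₂ g₂) :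
    IsWeakDeriv k (fun x => f₁ x - f₂ x) fun x => g₁ x - g₂ x := by
  refine ⟨h₁.1.sub h₂.1, fun φ hφ hc => ?_⟩
  have hk := (contDiff_iteratedDeriv_top hφ k).continuous
  have hkc := hasCompactSupport_iteratedDeriv hc k
  simp_rw [sub_mul]
  rw [integral_sub (integrable_mul_of_hasCompactSupport hf₁ hk hkc)
    (integrable_mul_of_hasCompactSupport hf₂ hk hkc),
    integral_sub (integrable_mul_of_hasCompactSupport h₁.1 hφ.continuous hc)
    (integrable_mul_of_hasCompactSupport h₂.1 hφ.continuous hc), h₁.2 φ hφ hc, h₂.2 φ hφ hc]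
  ring

/-- A test function of vanishing integral is the derivative of a test function. -/
theorem exists_primitive_of_integral_eq_zero {φ : ℝ → ℝ} (hφ : ContDiff ℝ (⊤ : ℕ∞) φ)
    (hc : HasCompactSupport φ) (h0 : ∫ x, φ x = 0) :
    ∃ ψ : ℝ → ℝ, ContDiff ℝ (⊤ : ℕ∞) ψ ∧ HasCompactSupport ψ ∧ deriv ψ = φ := by
  obtain ⟨R, hR0, hR⟩ := exists_Ioo_of_hasCompactSupport hc
  have hint : ∀ a b, IntervalIntegrable φ volume a b :=
    fun a b => hφ.continuous.intervalIntegrable a b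
  have hd : ∀ x, HasDerivAt (fun x => ∫ t in (-R)..x, φ t) (φ x) x := fun x =>
    intervalIntegral.integral_hasDerivAt_right (hint _ _)
      (hφ.continuous.stronglyMeasurableAtFilter _ _) hφ.continuous.continuousAt
  have hde : deriv (fun x => ∫ t in (-R)..x, φ t) = φ := funext fun x => (hd x).deriv
  have hz : ∀ x, x ∉ Ioo (-R) R → φ x = 0 := fun x hx =>
    image_eq_zero_of_notMem_tsupport fun h => hx (hR h)
  refine ⟨fun x => ∫ t in (-R)..x, φ t, ?_, ?_, hde⟩
  · rw [contDiff_infty_iff_deriv, hde]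
    exact ⟨fun x => (hd x).differentiableAt, hφ⟩
  · refine HasCompactSupport.intro (isCompact_Icc (a := -R) (b := R)) fun x hx => ?_
    rw [mem_Icc, not_and_or, not_le, not_le] at hx
    rcases hx with hx | hx
    · rw [intervalIntegral.integral_symm, neg_eq_zero]
      refine intervalIntegral.integral_zero_ae (Filter.Eventually.of_forall fun t ht => ?_)
      rw [uIoc_of_le hx.le] at ht
      exact hz t fun h => absurd h.1 (not_lt.2 ht.2)
    · rw [← h0]
      apply intervalIntegral.integral_eq_integral_of_support_subset
      intro t ht
      by_contra hn
      refine ht (hz t fun h => hn ⟨h.1, h.2.le.trans hx.le⟩)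

/-- A locally integrable function whose `k`-th weak derivative vanishes is a polynomial of degree
less than `k`. -/
theorem ae_eq_poly_of_weakDeriv_zero (k : ℕ) (u : ℝ → ℝ) (hu : LocallyIntegrable u volume)
    (h : ∀ φ : ℝ → ℝ, ContDiff ℝ (⊤ : ℕ∞) φ → HasCompactSupport φ →
      ∫ x, u x * iteratedDeriv k φ x = 0) :
    ∃ P : Polynomial ℝ, (P = 0 ∨ P.natDegree < k) ∧ u =ᵐ[volume] fun x => P.eval x := by
  induction k generalizing u with
  | zero =>
    refine ⟨0, Or.inl rfl, ?_⟩
    have := ae_eq_zero_of_integral_contDiff_smul_eq_zero hu fun φ hφ hc => by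
      have := h φ hφ hc
      simpa [mul_comm] using this
    filter_upwards [this] with x hx
    simpa using hx
  | succ k ih =>
    obtain ⟨θ⟩ : Nonempty (ContDiffBump (0 : ℝ)) := inferInstance
    set ρ : ℝ → ℝ := θ.normed volume
    have hρ : ContDiff ℝ (⊤ : ℕ∞) ρ := θ.contDiff_normed
    have hρc : HasCompactSupport ρ := θ.hasCompactSupport_normed
    have hρ1 : ∫ x, ρ x = 1 := θ.integral_normed
    set c : ℝ := ∫ x, u x * iteratedDeriv k ρ x
    -- Subtracting (∫ φ)ρ from φ leaves a test function of integral zero, hence a derivative of a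
    -- test function. So the pairing of u with the k-th derivative of φ depends only on ∫ φ.
    have key : ∀ φ : ℝ → ℝ, ContDiff ℝ (⊤ : ℕ∞) φ → HasCompactSupport φ →
        ∫ x, u x * iteratedDeriv k φ x = c * ∫ x, φ x := by
      intro φ hφ hc
      set m := ∫ x, φ x
      have hint : Integrable φ volume := hφ.continuous.integrable_of_hasCompactSupport hc
      have hintρ : Integrable ρ volume := hρ.continuous.integrable_of_hasCompactSupport hρc
      obtain ⟨ψ, hψ, hψc, hψd⟩ := exists_primitive_of_integral_eq_zero
        (φ := φ - m • ρ) (hφ.sub (hρ.const_smul m))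
        (hc.sub (hρc.smul_left (f := fun _ => m))) (by
          simp only [Pi.sub_apply, Pi.smul_apply, smul_eq_mul]
          rw [integral_sub hint (hintρ.const_mul m), integral_const_mul, hρ1]
          simp [m])
      have h1 := h ψ hψ hψc
      rw [iteratedDeriv_succ', hψd] at h1
      have e : ∀ x, iteratedDeriv k (φ - m • ρ) x =
          iteratedDeriv k φ x - m * iteratedDeriv k ρ x := by
        intro x
        have hm : ContDiff ℝ (⊤ : ℕ∞) (m • ρ) := hρ.const_smul m
        rw [iteratedDeriv_sub (hφ.contDiffAt.of_le (by exact_mod_cast le_top))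
          (hm.contDiffAt.of_le (by exact_mod_cast le_top)),
          iteratedDeriv_const_smul_field, smul_eq_mul]
      simp_rw [e, mul_sub] at h1
      have i1 := integrable_mul_of_hasCompactSupport hu (contDiff_iteratedDeriv_top hφ k).continuous
        (hasCompactSupport_iteratedDeriv hc k)
      have i2 := integrable_mul_of_hasCompactSupport hu (contDiff_iteratedDeriv_top hρ k).continuous
        (hasCompactSupport_iteratedDeriv hρc k)
      have e2 : ∀ x, u x * (m * iteratedDeriv k ρ x) = m * (u x * iteratedDeriv k ρ x) :=
        fun x => by ring
      simp_rw [e2] at h1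
      rw [integral_sub i1 (i2.const_mul m), integral_const_mul] at h1
      linarith
    -- The monomial d x^k has k-th derivative (-1)^k c, so its pairing with the k-th derivative of φ
    -- is exactly c ∫ φ. Subtracting it from u reduces the order by one.
    set d : ℝ := (-1) ^ k * c / k.factorial
    set M : Polynomial ℝ := Polynomial.C d * Polynomial.X ^ k
    have hM : (Polynomial.derivative^[k]) M = Polynomial.C ((-1) ^ k * c) := by
      simp only [M, Polynomial.iterate_derivative_C_mul, Polynomial.iterate_derivative_X_pow_eq_C_mul,
        Nat.sub_self, pow_zero, mul_one, Nat.descFactorial_self]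
      rw [← Polynomial.C_mul]
      congr 1
      have : (k.factorial : ℝ) ≠ 0 := by positivity
      simp only [d]
      field_simp
    obtain ⟨P, hP, hPu⟩ := ih (fun x => u x - M.eval x)
      (hu.sub (Polynomial.continuous _).locallyIntegrable) fun φ hφ hc => by
        have h1 := (poly_isWeakDeriv M k).2 φ hφ hc
        rw [hM] at h1
        simp only [Polynomial.eval_C] at h1
        rw [integral_const_mul] at h1
        simp_rw [sub_mul]
        rw [integral_sub (integrable_mul_of_hasCompactSupport hu
            (contDiff_iteratedDeriv_top hφ k).continuous (hasCompactSupport_iteratedDeriv hc k))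
          (integrable_mul_of_hasCompactSupport (Polynomial.continuous _).locallyIntegrable
            (contDiff_iteratedDeriv_top hφ k).continuous (hasCompactSupport_iteratedDeriv hc k)),
          key φ hφ hc, h1, ← mul_assoc, ← mul_assoc, ← mul_pow]
        norm_num
    refine ⟨P + M, Or.inr ?_, ?_⟩
    · refine Nat.lt_succ_of_le ((Polynomial.natDegree_add_le _ _).trans (max_le ?_ ?_))
      · rcases hP with rfl | hP
        · simp
        · exact hP.le
      · exact Polynomial.natDegree_C_mul_X_pow_le d k
    · filter_upwards [hPu] with x hx
      rw [Polynomial.eval_add, ← hx]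
      ring

/-- Taylor's formula for functions with a `k`-th weak derivative. -/
theorem exists_ae_eq_prim_add_poly {k : ℕ} (hk : 1 ≤ k) {f g : ℝ → ℝ}
    (hf : LocallyIntegrable f volume) (h : IsWeakDeriv k f g) (a : ℝ) :
    ∃ P : Polynomial ℝ, P.natDegree < k ∧
      f =ᵐ[volume] fun x => prim a k g x + P.eval x := by
  have hl := prim_locallyIntegrable h.1 a k
  obtain ⟨P, hP, hPu⟩ := ae_eq_poly_of_weakDeriv_zero k (fun x => f x - prim a k g x)
    (hf.sub hl) fun φ hφ hc => by
      have := (h.sub hf hl (prim_isWeakDeriv h.1 a k)).2 φ hφ hc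
      simpa using this
  refine ⟨P, ?_, ?_⟩
  · rcases hP with rfl | hP
    · rw [Polynomial.natDegree_zero]; exact hk
    · exact hP
  · filter_upwards [hPu] with x hx
    rw [← hx]
    ring

/-! ### Differences of iterated primitives -/

theorem diff_succ_apply (k : ℕ) (h : ℝ) (F : ℝ → ℝ) (x : ℝ) :
    diff (k + 1) h F x = diff k h (fun y => F (y + h) - F y) x := by
  rw [diff_eq_fwdDiff, diff_eq_fwdDiff, Function.iterate_succ_apply]
  rfl

/-- One difference turns the primitive into the integral of u(y + s) over s in [0,h], and the other
k pass under the integral. Iterating, the k-th difference of a k-fold primitive is the integral of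
g(x + s₁ + … + s_k) over the cube [0,h]^k; both the upper and the lower bounds below come from this.
-/
theorem diff_succ_primitive {u : ℝ → ℝ} (hu : LocallyIntegrable u volume) (a : ℝ) (k : ℕ)
    (h x : ℝ) : diff (k + 1) h (fun y => ∫ t in a..y, u t) x =
      ∫ s in (0 : ℝ)..h, diff k h u (x + s) := by
  have hi := intervalIntegrable_of_locallyIntegrable hu
  have hs : ∀ c : ℝ, IntervalIntegrable (fun s => u (c + s)) volume 0 h := fun c => by
    have := (hi (c + 0) (c + h)).comp_add_left c
    simpa using this
  rw [diff_succ_apply]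
  simp only [diff]
  rw [intervalIntegral.integral_finsetSum]
  · refine Finset.sum_congr rfl fun j _ => ?_
    rw [intervalIntegral.integral_const_mul]
    congr 1
    rw [intervalIntegral.integral_interval_sub_left (hi _ _) (hi _ _)]
    have e : ∀ s, u (x + s + j * h) = u (x + j * h + s) := fun s => by congr 1; ring
    simp_rw [e]
    rw [intervalIntegral.integral_comp_add_left (fun s => u s), add_zero]
  · intro j _
    refine IntervalIntegrable.const_mul ?_ _
    have e : ∀ s, u (x + s + j * h) = u (x + j * h + s) := fun s => by congr 1; ring
    simp_rw [e]
    exact hs _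

theorem diff_one (h : ℝ) (F : ℝ → ℝ) (x : ℝ) : diff 1 h F x = F (x + h) - F x := by
  rw [diff_succ_apply]
  simp [diff]

theorem diff_one_primitive {u : ℝ → ℝ} (hu : LocallyIntegrable u volume) (a h x : ℝ) :
    diff 1 h (fun y => ∫ t in a..y, u t) x = ∫ t in x..(x + h), u t := by
  have hi := intervalIntegrable_of_locallyIntegrable hu
  rw [diff_one, intervalIntegral.integral_interval_sub_left (hi _ _) (hi _ _)]

theorem continuous_diff {F : ℝ → ℝ} (hF : Continuous F) (k : ℕ) (h : ℝ) :
    Continuous (diff k h F) := by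
  unfold diff
  fun_prop

theorem enorm_intervalIntegral_le (u : ℝ → ℝ) (a b : ℝ) :
    ‖∫ t in a..b, u t‖ₑ ≤ ∫⁻ t in uIoc a b, ‖u t‖ₑ := by
  have : ‖∫ t in a..b, u t‖ₑ = ‖∫ t in uIoc a b, u t‖ₑ := by
    rw [← ofReal_norm, ← ofReal_norm,
      intervalIntegral.norm_integral_eq_norm_integral_uIoc]
  rw [this]
  exact enorm_integral_le_lintegral_enorm _

/-- In the cube representation one variable integrates |g| inside the ball, and each of the
remaining k variables costs a factor |h|. -/
theorem enorm_diff_prim_le {g : ℝ → ℝ} (hg : LocallyIntegrable g volume) (a : ℝ) (k : ℕ)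
    (h x : ℝ) : ‖diff (k + 1) h (prim a (k + 1) g) x‖ₑ ≤
      ENNReal.ofReal |h| ^ k * ∫⁻ y in Metric.closedBall x ((k + 1) * |h|), ‖g y‖ₑ := by
  induction k generalizing x with
  | zero =>
    have := diff_one_primitive hg a h x
    change ‖diff 1 h (fun y => ∫ t in a..y, g t) x‖ₑ ≤ _
    rw [this, pow_zero, one_mul]
    refine (enorm_intervalIntegral_le _ _ _).trans (lintegral_mono_set fun t ht => ?_)
    have ht' := uIoc_subset_uIcc ht
    rw [Metric.mem_closedBall, Real.dist_eq]
    have := abs_sub_left_of_mem_uIcc ht'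
    rw [add_sub_cancel_left] at this
    simpa using this
  | succ k ih =>
    change ‖diff (k + 1 + 1) h (fun y => ∫ t in a..y, prim a (k + 1) g t) x‖ₑ ≤ _
    rw [diff_succ_primitive (prim_locallyIntegrable hg a (k + 1))]
    refine (enorm_intervalIntegral_le _ _ _).trans ?_
    calc ∫⁻ s in uIoc 0 h, ‖diff (k + 1) h (prim a (k + 1) g) (x + s)‖ₑ
        ≤ ∫⁻ _ in uIoc 0 h, ENNReal.ofReal |h| ^ k *
          ∫⁻ y in Metric.closedBall x (((k + 1 : ℕ) + 1) * |h|), ‖g y‖ₑ := by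
          refine setLIntegral_mono' measurableSet_uIoc fun s hs => ?_
          refine (ih (x + s)).trans ?_
          gcongr
          refine Metric.closedBall_subset_closedBall' ?_
          have := abs_sub_left_of_mem_uIcc (uIoc_subset_uIcc hs)
          rw [Real.dist_eq, add_sub_cancel_left]
          simp only [sub_zero] at this
          push_cast
          linarith
      _ = _ := by
          rw [setLIntegral_const, Real.volume_uIoc, sub_zero, pow_succ]
          ring

/-- As g ≥ 0, the cube may be shrunk: k variables are confined to [σ, σ + w] while the last runs
over [0,h]. Whatever the values of the k confined variables, the argument of g then sweeps across
[u,v]. -/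
theorem diff_prim_ge {g : ℝ → ℝ} (hg : LocallyIntegrable g volume) (h0 : ∀ x, 0 ≤ g x) (a : ℝ)
    (k : ℕ) {h x σ w u v : ℝ} (hσ : 0 ≤ σ) (hw : 0 ≤ w) (hh : σ + w ≤ h)
    (hu : x + k * (σ + w) ≤ u) (hv : v ≤ x + k * σ + h) :
    w ^ k * ∫ y in Icc u v, g y ≤ diff (k + 1) h (prim a (k + 1) g) x := by
  induction k generalizing x σ w u v with
  | zero =>
    change _ ≤ diff 1 h (fun y => ∫ t in a..y, g t) x
    rw [diff_one_primitive hg, pow_zero, one_mul, intervalIntegral.integral_of_le (by linarith),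
      ← integral_Icc_eq_integral_Ioc]
    refine setIntegral_mono_set (hg.integrableOn_isCompact isCompact_Icc)
      (Filter.Eventually.of_forall h0) (Filter.Eventually.of_forall ?_)
    refine Icc_subset_Icc ?_ ?_
    · simpa using hu
    · simpa using hv
  | succ k ih =>
    change _ ≤ diff (k + 1 + 1) h (fun y => ∫ t in a..y, prim a (k + 1) g t) x
    rw [diff_succ_primitive (prim_locallyIntegrable hg a (k + 1))]
    have hc : Continuous fun s => diff (k + 1) h (prim a (k + 1) g) (x + s) :=
      (continuous_diff (prim_continuous hg a k) _ _).comp (by fun_prop)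
    -- Nonnegativity is the degenerate case w = 0 over a one-point interval; the latter matters for
    -- k = 0, where 0 ^ 0 = 1.
    have hpos : ∀ s, 0 ≤ diff (k + 1) h (prim a (k + 1) g) (x + s) := fun s => by
      have := ih (x := x + s) (σ := 0) (w := 0) (u := x + s) (v := x + s) le_rfl le_rfl
        (by linarith) (by simp) (by simp; linarith)
      simpa using this
    calc w ^ (k + 1) * ∫ y in Icc u v, g y
        = ∫ _ in σ..(σ + w), w ^ k * ∫ y in Icc u v, g y := by
          rw [intervalIntegral.integral_const, add_sub_cancel_left, smul_eq_mul, pow_succ]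
          ring
      _ ≤ ∫ s in σ..(σ + w), diff (k + 1) h (prim a (k + 1) g) (x + s) := by
          refine intervalIntegral.integral_mono_on (by linarith) (by simp)
            (hc.intervalIntegrable _ _) fun s hs => ?_
          push_cast at hu hv
          refine ih (σ := σ) (w := w) hσ hw hh ?_ ?_
          · linarith [hs.2]
          · linarith [hs.1]
      _ ≤ _ := intervalIntegral.integral_mono_interval hσ (by linarith) hh
          (Filter.Eventually.of_forall hpos) (hc.intervalIntegrable _ _)

/-- Reading the alternating sum backwards turns a negative step into a positive one started at the
other end. -/
theorem abs_diff_neg (k : ℕ) (h : ℝ) (f : ℝ → ℝ) (x : ℝ) :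
    |diff k (-h) f x| = |diff k h f (x - k * h)| := by
  have : diff k (-h) f x = (-1) ^ k * diff k h f (x - k * h) := by
    unfold diff
    rw [← Finset.sum_range_reflect, Finset.mul_sum]
    refine Finset.sum_congr rfl fun j hj => ?_
    have hj' : j ≤ k := by have := Finset.mem_range.1 hj; omega
    have e1 : k + 1 - 1 - j = k - j := by omega
    have e2 : k - (k - j) = j := by omega
    have e3 : (-1 : ℝ) ^ k * (-1) ^ (k - j) = (-1) ^ j := by
      rw [← pow_add, show k + (k - j) = j + 2 * (k - j) by omega, pow_add, pow_mul]
      norm_num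
    rw [e1, e2, Nat.choose_symm hj', Nat.cast_sub hj',
      show x + ((k : ℝ) - j) * -h = x - k * h + j * h by ring, ← e3]
    ring
  rw [this, abs_mul, abs_pow, abs_neg, abs_one, one_pow, one_mul]

theorem diff_poly_eq_zero {k : ℕ} {P : Polynomial ℝ} (hP : P.natDegree < k) (h x : ℝ) :
    diff k h (fun y => P.eval y) x = 0 := by
  -- As a polynomial in the index j, P(x + jh) still has degree less than k, so its k-th difference
  -- with step 1 vanishes.
  set R := P.comp (Polynomial.C h * Polynomial.X + Polynomial.C x)
  have hR : R.natDegree < k := by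
    refine lt_of_le_of_lt (Polynomial.natDegree_comp_le.trans ?_) hP
    have : (Polynomial.C h * Polynomial.X + Polynomial.C x).natDegree ≤ 1 :=
      Polynomial.natDegree_linear_le
    nlinarith [Nat.zero_le P.natDegree]
  have h0 := congrFun (Polynomial.fwdDiff_iter_eq_zero_of_degree_lt hR) 0
  rw [← diff_eq_fwdDiff] at h0
  rw [Pi.zero_apply] at h0
  rw [← h0]
  unfold diff
  refine Finset.sum_congr rfl fun j _ => ?_
  simp only [R, Polynomial.eval_comp, Polynomial.eval_add, Polynomial.eval_mul, Polynomial.eval_C,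
    Polynomial.eval_X]
  congr 2
  ring

theorem diff_add (k : ℕ) (h : ℝ) (F G : ℝ → ℝ) (x : ℝ) :
    diff k h (fun y => F y + G y) x = diff k h F x + diff k h G x := by
  simp only [diff, mul_add, Finset.sum_add_distrib]

/-- The term j = 0 excludes a null set of x. For j ≥ 1 and fixed x, the map h ↦ x + jh pulls null
sets back to null sets, so only a null set of h is lost. This suffices because the functional
integrates in h first. -/
theorem diff_congr_ae {f F : ℝ → ℝ} (hfF : f =ᵐ[volume] F) (k : ℕ) :
    ∀ᵐ x, ∀ᵐ h, diff k h f x = diff k h F x := by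
  filter_upwards [hfF] with x hx
  have : ∀ j ∈ Finset.range (k + 1), ∀ᵐ h : ℝ, f (x + j * h) = F (x + j * h) := by
    intro j _
    rcases Nat.eq_zero_or_pos j with rfl | hj
    · simp [hx]
    · have hj' : (j : ℝ) ≠ 0 := by positivity
      rw [ae_iff]
      have e : {h : ℝ | ¬ f (x + j * h) = F (x + j * h)} =
          (fun h => (j : ℝ) * h) ⁻¹' ((fun y => x + y) ⁻¹' {y | ¬ f y = F y}) := rfl
      rw [e, Real.volume_preimage_mul_left hj', measure_preimage_add, ae_iff.1 hfF, mul_zero]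
  have h' := (Filter.eventually_all_finset _).2 this
  filter_upwards [h'] with h hh
  unfold diff
  exact Finset.sum_congr rfl fun j hj => by rw [hh j hj]

/-- The pointwise bound of differences by integrals of the weak derivative. -/
theorem enorm_diff_le {k : ℕ} (hk : 1 ≤ k) {f g : ℝ → ℝ} (hf : LocallyIntegrable f volume)
    (h : IsWeakDeriv k f g) : ∀ᵐ x, ∀ᵐ s, ‖diff k s f x‖ₑ ≤
      ENNReal.ofReal |s| ^ (k - 1) * ∫⁻ y in Metric.closedBall x (k * |s|), ‖g y‖ₑ := by
  obtain ⟨P, hP, hPf⟩ := exists_ae_eq_prim_add_poly hk hf h 0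
  obtain ⟨k, rfl⟩ := Nat.exists_eq_add_of_le' hk
  filter_upwards [diff_congr_ae hPf (k + 1)] with x hx
  filter_upwards [hx] with s hs
  rw [hs, diff_add, diff_poly_eq_zero hP, add_zero, Nat.add_sub_cancel]
  have := enorm_diff_prim_le h.1 0 k s x
  push_cast
  exact this

/-! ### Local polynomial approximation -/

theorem abs_prim_le {g : ℝ → ℝ} (hg : LocallyIntegrable g volume) {a b : ℝ} (hab : a ≤ b) (k : ℕ) {x : ℝ}
    (hx : x ∈ Icc a b) : |prim a (k + 1) g x| ≤ (b - a) ^ k * ∫ y in Icc a b, |g y| := by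
  have h0 : 0 ≤ ∫ y in Icc a b, |g y| := integral_nonneg fun _ => abs_nonneg _
  induction k generalizing x with
  | zero =>
    change |∫ t in a..x, g t| ≤ _
    rw [pow_zero, one_mul, intervalIntegral.integral_of_le hx.1]
    refine (abs_integral_le_integral_abs).trans ?_
    exact setIntegral_mono_set (hg.integrableOn_isCompact isCompact_Icc).abs
      (Filter.Eventually.of_forall fun _ => abs_nonneg _)
      (Filter.Eventually.of_forall fun t ht => ⟨ht.1.le, ht.2.trans hx.2⟩)
  | succ k ih =>
    change |∫ t in a..x, prim a (k + 1) g t| ≤ _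
    have := intervalIntegral.norm_integral_le_of_norm_le_const (a := a) (b := x)
      (f := prim a (k + 1) g) (C := (b - a) ^ k * ∫ y in Icc a b, |g y|) fun t ht => by
        rw [uIoc_of_le hx.1] at ht
        exact ih ⟨ht.1.le, ht.2.trans hx.2⟩
    rw [Real.norm_eq_abs, abs_of_nonneg (sub_nonneg.2 hx.1)] at this
    refine this.trans ?_
    rw [pow_succ]
    have h1 : 0 ≤ (b - a) ^ k := pow_nonneg (by linarith) _
    have h2 : x - a ≤ b - a := by linarith [hx.2]
    calc _ ≤ ((b - a) ^ k * ∫ y in Icc a b, |g y|) * (b - a) := by gcongr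
      _ = _ := by ring

theorem IsMinPoly.integral_mul_eq_zero {s : ℕ} {f : ℝ → ℝ} {a b : ℝ} {M : Polynomial ℝ}
    (hf : LocallyIntegrable f volume) (hM : IsMinPoly s f (Ico a b) M) {R : Polynomial ℝ}
    (hR : R.natDegree ≤ s) : ∫ x in Ico a b, (f x - M.eval x) * R.eval x = 0 := by
  have e : (fun x : ℝ => (f x - M.eval x) * R.eval x) =
      fun x => ∑ i ∈ Finset.range (R.natDegree + 1), R.coeff i * ((f x - M.eval x) * x ^ i) := by
    funext x
    rw [Polynomial.eval_eq_sum_range (p := R), Finset.mul_sum]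
    exact Finset.sum_congr rfl fun i _ => by ring
  rw [e, integral_finsetSum]
  · refine Finset.sum_eq_zero fun i hi => ?_
    rw [integral_const_mul, hM.2 i (by have := Finset.mem_range.1 hi; omega), mul_zero]
  · intro i _
    refine Integrable.const_mul ?_ _
    have : LocallyIntegrable (fun x => f x - M.eval x) volume :=
      hf.sub (Polynomial.continuous _).locallyIntegrable
    exact ((this.integrableOn_isCompact isCompact_Icc).mul_continuousOn (by fun_prop)
      isCompact_Icc).mono_set Ico_subset_Icc_self

/-- The `L¹` distance to the minimizing polynomial is controlled by the uniform distance to any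
polynomial of admissible degree. -/
theorem integral_abs_sub_minPoly_le {s : ℕ} {f V : ℝ → ℝ} {a b B : ℝ} (hab : a < b) {M P : Polynomial ℝ}
    (hf : LocallyIntegrable f volume) (hM : IsMinPoly s f (Ico a b) M) (hP : P.natDegree ≤ s)
    (hV : Continuous V) (hfV : f =ᵐ[volume] fun x => V x + P.eval x)
    (hB : ∀ x ∈ Icc a b, |V x| ≤ B) :
    ∫ x in Ico a b, |f x - M.eval x| ≤ (b - a) * B := by
  set U : ℝ → ℝ := fun x => V x + (P - M).eval x
  have hUc : Continuous U := hV.add (Polynomial.continuous _)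
  have hU : ∀ᵐ x ∂(volume.restrict (Ico a b)), f x - M.eval x = U x := by
    filter_upwards [ae_restrict_of_ae hfV] with x hx
    simp only [U, hx, Polynomial.eval_sub]
    ring
  have hci : ∀ F : ℝ → ℝ, Continuous F → IntegrableOn F (Ico a b) volume := fun F hF =>
    (hF.integrableOn_Icc (a := a) (b := b)).mono_set Ico_subset_Icc_self
  have horth : ∫ x in Ico a b, U x * (P - M).eval x = 0 := by
    rw [← hM.integral_mul_eq_zero hf (R := P - M)
      ((Polynomial.natDegree_sub_le _ _).trans (max_le hP hM.1))]
    refine integral_congr_ae ?_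
    filter_upwards [hU] with x hx
    rw [hx]
  have hvol : (volume : Measure ℝ).real (Ico a b) = b - a := by
    rw [Measure.real, Real.volume_Ico, ENNReal.toReal_ofReal (by linarith)]
  -- U agrees a.e. with f - M, hence is orthogonal to P - M = U - V. The quadratic inequality below
  -- then controls ∫ U² by ∫ V².
  have hUV : ∫ x in Ico a b, U x ^ 2 = ∫ x in Ico a b, U x * V x := by
    have : ∀ x, U x ^ 2 = U x * V x + U x * (P - M).eval x := fun x => by
      simp only [U]; ring
    simp_rw [this]
    rw [integral_add (hci (fun x => U x * V x) (hUc.mul hV))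
      (hci (fun x => U x * (P - M).eval x) (hUc.mul (Polynomial.continuous _))), horth,
      add_zero]
  -- A strictly larger B' is positive even when B = 0, so it can be divided by; the limit B' → B is
  -- taken at the end.
  have main : ∀ B', B < B' → ∫ x in Ico a b, |f x - M.eval x| ≤ (b - a) * B' := by
    intro B' hBB'
    have hB0 : 0 ≤ B := (abs_nonneg _).trans (hB a ⟨le_rfl, hab.le⟩)
    have hB' : 0 < B' := by linarith
    have hU2 : ∫ x in Ico a b, U x ^ 2 ≤ (b - a) * B' ^ 2 := by
      have h1 : ∫ x in Ico a b, U x * V x ≤ ∫ x in Ico a b, (U x ^ 2 / 2 + B' ^ 2 / 2) := by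
        refine setIntegral_mono_on (hci _ (hUc.mul hV)) (hci _ (by fun_prop)) measurableSet_Ico
          fun x hx => ?_
        have h2 : V x ^ 2 ≤ B' ^ 2 :=
          sq_le_sq' (by linarith [(abs_le.1 (hB x ⟨hx.1, hx.2.le⟩)).1])
            (by linarith [(abs_le.1 (hB x ⟨hx.1, hx.2.le⟩)).2])
        nlinarith [sq_nonneg (U x - V x)]
      rw [integral_add (hci _ (by fun_prop)) (hci _ (by fun_prop)), integral_div,
        setIntegral_const, hvol, smul_eq_mul, ← hUV] at h1
      linarith
    calc ∫ x in Ico a b, |f x - M.eval x| = ∫ x in Ico a b, |U x| := by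
          refine integral_congr_ae ?_
          filter_upwards [hU] with x hx
          rw [hx]
      _ ≤ ∫ x in Ico a b, (U x ^ 2 / (2 * B') + B' / 2) := by
          refine setIntegral_mono_on (hci _ (by fun_prop)) (hci _ (by fun_prop)) measurableSet_Ico
            fun x _ => ?_
          have : U x ^ 2 / (2 * B') + B' / 2 - |U x| = (|U x| - B') ^ 2 / (2 * B') := by
            rw [← sq_abs (U x)]; field_simp; ring
          have h3 : 0 ≤ (|U x| - B') ^ 2 / (2 * B') := by positivity
          linarith
      _ = (∫ x in Ico a b, U x ^ 2) / (2 * B') + (b - a) * (B' / 2) := by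
          rw [integral_add (hci _ (by fun_prop)) (hci _ (by fun_prop)), integral_div,
            setIntegral_const, hvol, smul_eq_mul]
      _ ≤ ((b - a) * B' ^ 2) / (2 * B') + (b - a) * (B' / 2) := by gcongr
      _ = (b - a) * B' := by field_simp; ring
  have hlim : Filter.Tendsto (fun B' => (b - a) * B') (nhdsWithin B (Ioi B))
      (nhds ((b - a) * B)) :=
    ((continuous_const.mul continuous_id).tendsto B).mono_left nhdsWithin_le_nhds
  exact ge_of_tendsto hlim (Filter.eventually_of_mem self_mem_nhdsWithin fun B' h => main B' h)

/-- The Poincaré inequality for local polynomial approximation. -/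
theorem localApprox_le {k : ℕ} (hk : 1 ≤ k) {f g : ℝ → ℝ} (hf : LocallyIntegrable f volume)
    (h : IsWeakDeriv k f g) {a b : ℝ} (hab : a < b) :
    localApprox k f (Ico a b) ≤ ENNReal.ofReal (b - a) ^ k * ∫⁻ x in Icc a b, ‖g x‖ₑ := by
  obtain ⟨P, hP, hPf⟩ := exists_ae_eq_prim_add_poly hk hf h a
  obtain ⟨k, rfl⟩ := Nat.exists_eq_add_of_le' hk
  have hM := minPoly_spec k hf hab
  have key := integral_abs_sub_minPoly_le hab hf hM (Nat.lt_succ_iff.1 hP) (prim_continuous h.1 a k)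
    hPf fun x hx => abs_prim_le h.1 hab.le k hx
  have hint : IntegrableOn (fun x => f x - (minPoly k f (Ico a b)).eval x) (Ico a b) volume :=
    ((hf.sub (Polynomial.continuous _).locallyIntegrable).integrableOn_isCompact
      isCompact_Icc).mono_set Ico_subset_Icc_self
  have hg : IntegrableOn g (Icc a b) volume := h.1.integrableOn_isCompact isCompact_Icc
  rw [localApprox, Nat.add_sub_cancel, ← ofReal_integral_norm_eq_lintegral_enorm hint,
    ← ofReal_integral_norm_eq_lintegral_enorm hg, ← ENNReal.ofReal_pow (by linarith),
    ← ENNReal.ofReal_mul (by have : 0 < b - a := by linarith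
                             positivity)]
  refine ENNReal.ofReal_le_ofReal (key.trans (le_of_eq ?_))
  simp only [Real.norm_eq_abs]
  ring

/-- A lower bound for the local approximation of functions with a nonnegative derivative that is
concentrated in the middle of the interval. -/
theorem exists_le_localApprox (k : ℕ) (hk : 1 ≤ k) : ∃ c : ℝ, 0 < c ∧ ∀ (f g : ℝ → ℝ) (a b : ℝ), a < b →
    LocallyIntegrable f volume → IsWeakDeriv k f g → (∀ x, 0 ≤ g x) →
    (∀ x, x ∉ Icc (a + (b - a) / 8) (b - (b - a) / 8) → g x = 0) →
    ENNReal.ofReal (c * (b - a) ^ k * ∫ x, g x) ≤ localApprox k f (Ico a b) := by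
  -- Rescaled to [a,b], the bump equals 1 on the middle three quarters, where g lives, and is
  -- supported in [a,b].
  let θ : ContDiffBump (0 : ℝ) := ⟨3 / 8, 1 / 2, by norm_num, by norm_num⟩
  have hθ : ContDiff ℝ (⊤ : ℕ∞) θ := θ.contDiff
  obtain ⟨C, hC⟩ := (hasCompactSupport_iteratedDeriv θ.hasCompactSupport k).exists_bound_of_continuous
    (contDiff_iteratedDeriv_top hθ k).continuous
  have hC1 : 0 < max C 1 := lt_max_of_lt_right one_pos
  refine ⟨(max C 1)⁻¹, inv_pos.2 hC1, fun f g a b hab hf h h0 hsupp => ?_⟩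
  have hba : 0 < b - a := by linarith
  set s : ℝ := (b - a)⁻¹
  have hs : 0 < s := inv_pos.2 hba
  have hsb : s * (b - a) = 1 := inv_mul_cancel₀ hba.ne'
  set d : ℝ := -(s * ((a + b) / 2))
  set φ : ℝ → ℝ := fun x => θ (s * x + d)
  have hφ : ContDiff ℝ (⊤ : ℕ∞) φ := hθ.comp (by fun_prop)
  have harg : ∀ x, s * x + d = s * (x - (a + b) / 2) := fun x => by simp only [d]; ring
  have hφd : ∀ x, iteratedDeriv k φ x = s ^ k * iteratedDeriv k θ (s * x + d) := by
    intro x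
    have h1 : ContDiff ℝ k fun z => θ (z + d) :=
      (hθ.comp (by fun_prop : ContDiff ℝ (⊤ : ℕ∞) fun z : ℝ => z + d)).of_le
        (by exact_mod_cast le_top)
    have := congrFun (iteratedDeriv_comp_const_mul h1 s) x
    rw [this, iteratedDeriv_comp_add_const]
  have hout : ∀ x, x ∉ Icc a b → s * x + d ∉ tsupport θ := by
    intro x hx hmem
    rw [θ.tsupport_eq, Metric.mem_closedBall, dist_zero_right, harg, Real.norm_eq_abs, abs_mul,
      abs_of_pos hs] at hmem
    have h1 : |x - (a + b) / 2| ≤ (b - a) / 2 := by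
      have : (b - a) * (s * |x - (a + b) / 2|) ≤ (b - a) * (1 / 2) := by gcongr
      rw [← mul_assoc, mul_comm (b - a) s, hsb] at this
      linarith
    rw [abs_le] at h1
    exact hx ⟨by linarith [h1.1], by linarith [h1.2]⟩
  have hφc : HasCompactSupport φ := HasCompactSupport.intro (isCompact_Icc (a := a) (b := b))
    fun x hx => image_eq_zero_of_notMem_tsupport (f := θ) (hout x hx)
  have hone : ∀ x, g x * φ x = g x := by
    intro x
    by_cases hx : x ∈ Icc (a + (b - a) / 8) (b - (b - a) / 8)
    · have : φ x = 1 := θ.one_of_mem_closedBall (by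
        rw [Metric.mem_closedBall, dist_zero_right, harg, Real.norm_eq_abs, abs_mul, abs_of_pos hs]
        change _ ≤ (3 / 8 : ℝ)
        have h1 : |x - (a + b) / 2| ≤ (b - a) * (3 / 8) :=
          abs_le.2 ⟨by linarith [hx.1], by linarith [hx.2]⟩
        calc s * |x - (a + b) / 2| ≤ s * ((b - a) * (3 / 8)) := by gcongr
          _ = 3 / 8 := by rw [← mul_assoc, hsb, one_mul])
      rw [this, mul_one]
    · rw [hsupp x hx, zero_mul]
  have hM := minPoly_spec (k - 1) hf hab
  set M := minPoly (k - 1) f (Ico a b)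
  have hMz : (Polynomial.derivative^[k]) M = 0 :=
    Polynomial.iterate_derivative_eq_zero (lt_of_le_of_lt hM.1 (by omega))
  have hMd := (poly_isWeakDeriv M k).2 φ hφ hφc
  rw [hMz] at hMd
  simp only [Polynomial.eval_zero, zero_mul, integral_zero, mul_zero] at hMd
  have hfd := h.2 φ hφ hφc
  simp_rw [hone] at hfd
  have hkc := (contDiff_iteratedDeriv_top hφ k).continuous
  have hkcs := hasCompactSupport_iteratedDeriv hφc k
  have hlu : LocallyIntegrable (fun x => f x - M.eval x) volume :=
    hf.sub (Polynomial.continuous _).locallyIntegrable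
  -- Testing against the k-th derivative of φ annihilates the minimizing polynomial and returns ∫ g
  -- up to sign, while that derivative is of size (b - a)^(-k).
  have hsub : ∫ x, (f x - M.eval x) * iteratedDeriv k φ x = (-1) ^ k * ∫ x, g x := by
    simp_rw [sub_mul]
    rw [integral_sub (integrable_mul_of_hasCompactSupport hf hkc hkcs)
      (integrable_mul_of_hasCompactSupport (Polynomial.continuous _).locallyIntegrable hkc hkcs),
      hfd, hMd, sub_zero]
  have hset : ∫ x, (f x - M.eval x) * iteratedDeriv k φ x =
      ∫ x in Icc a b, (f x - M.eval x) * iteratedDeriv k φ x := by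
    symm
    refine setIntegral_eq_integral_of_forall_compl_eq_zero fun x hx => ?_
    rw [hφd, image_eq_zero_of_notMem_tsupport fun hm => hout x hx (tsupport_iteratedDeriv_subset k hm),
      mul_zero, mul_zero]
  have hint : IntegrableOn (fun x => f x - M.eval x) (Icc a b) volume :=
    hlu.integrableOn_isCompact isCompact_Icc
  have hbound : ∫ x, g x ≤ (∫ x in Icc a b, |f x - M.eval x|) * (s ^ k * max C 1) := by
    have hgi : 0 ≤ ∫ x, g x := integral_nonneg h0
    calc ∫ x, g x = |(-1) ^ k * ∫ x, g x| := by
          rw [abs_mul, abs_pow, abs_neg, abs_one, one_pow, one_mul, abs_of_nonneg hgi]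
      _ = |∫ x in Icc a b, (f x - M.eval x) * iteratedDeriv k φ x| := by rw [← hsub, hset]
      _ ≤ ∫ x in Icc a b, |(f x - M.eval x) * iteratedDeriv k φ x| := abs_integral_le_integral_abs
      _ ≤ ∫ x in Icc a b, |f x - M.eval x| * (s ^ k * max C 1) := by
          refine setIntegral_mono_on ?_ (hint.abs.mul_const _) measurableSet_Icc fun x _ => ?_
          · exact (integrable_mul_of_hasCompactSupport hlu hkc hkcs).integrableOn.abs
          · rw [abs_mul, hφd, abs_mul, abs_of_pos (pow_pos hs k)]
            gcongr
            exact (hC _).trans (le_max_left _ _)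
      _ = _ := integral_mul_const _ _
  rw [localApprox, ←
    ofReal_integral_norm_eq_lintegral_enorm (hint.mono_set Ico_subset_Icc_self)]
  refine ENNReal.ofReal_le_ofReal ?_
  simp only [Real.norm_eq_abs]
  rw [← integral_Icc_eq_integral_Ico]
  have hsk : s ^ k * (b - a) ^ k = 1 := by rw [← mul_pow, hsb, one_pow]
  calc (max C 1)⁻¹ * (b - a) ^ k * ∫ x, g x
      ≤ (max C 1)⁻¹ * (b - a) ^ k *
        ((∫ x in Icc a b, |f x - M.eval x|) * (s ^ k * max C 1)) := by gcongr
    _ = (∫ x in Icc a b, |f x - M.eval x|) * (s ^ k * (b - a) ^ k) *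
        ((max C 1)⁻¹ * max C 1) := by ring
    _ = _ := by rw [hsk, inv_mul_cancel₀ hC1.ne', mul_one, mul_one]

/-! ### Muckenhoupt weights and averages -/

/-- The averages over intervals are bounded from `L^p(υ)` with constant `K`. -/
def AvgBound (p : ℝ) (υ : ℝ → ℝ) (K : ℝ≥0∞) : Prop :=
  ∀ a b : ℝ, a < b → ∀ g : ℝ → ℝ, AEMeasurable g volume →
    (∫⁻ x in Icc a b, ‖g x‖ₑ) ^ p * ∫⁻ x in Icc a b, ENNReal.ofReal (υ x) ≤
      K * ENNReal.ofReal (b - a) ^ p * ∫⁻ x in Icc a b, ‖g x‖ₑ ^ p * ENNReal.ofReal (υ x)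

theorem mul_div_rpow_div {W S L : ℝ≥0∞} {p : ℝ} (hp : 1 ≤ p) (hL0 : L ≠ 0) (hL : L ≠ ∞) :
    W / L * (S / L) ^ (p - 1) = W * S ^ (p - 1) / L ^ p := by
  have : L ^ p = L * L ^ (p - 1) := by
    conv_lhs => rw [show p = 1 + (p - 1) by ring, ENNReal.rpow_add _ _ hL0 hL, ENNReal.rpow_one]
  rw [this, ENNReal.div_rpow_of_nonneg _ _ (by linarith), ENNReal.div_eq_inv_mul,
    ENNReal.div_eq_inv_mul, ENNReal.div_eq_inv_mul, ENNReal.mul_inv (Or.inl hL0) (Or.inl hL)]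
  ring

/-- For p > 1 this is Hölder's inequality for |g| = (|g| υ^(1/p)) · υ^(-1/p); for p = 1 the second
factor is replaced by the essential supremum of 1/υ. -/
theorem IsAp.avgBound {p : ℝ} (hp : 1 ≤ p) {υ : ℝ → ℝ} (h : IsAp p υ) :
    AvgBound p υ (apConst p υ) := by
  obtain ⟨h0, hl, hK⟩ := h
  intro a b hab g hg
  set K := apConst p υ
  set w : ℝ → ℝ≥0∞ := fun x => ENNReal.ofReal (υ x)
  have hw : AEMeasurable w volume := hl.aestronglyMeasurable.aemeasurable.ennreal_ofReal
  have hwtop : ∀ x, w x ≠ ∞ := fun x => ENNReal.ofReal_ne_top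
  set W := ∫⁻ x in Icc a b, w x
  set L := ENNReal.ofReal (b - a)
  have hL0 : L ≠ 0 := by simp [L, hab]
  have hL : L ≠ ∞ := ENNReal.ofReal_ne_top
  have hb := le_iSup_of_le (f := fun a : ℝ => ⨆ (b : ℝ) (_ : a < b),
    if p = 1 then
      (⨍⁻ x in Icc a b, ENNReal.ofReal (υ x) ∂volume) *
        essSup (fun x => (ENNReal.ofReal (υ x))⁻¹) (volume.restrict (Icc a b))
    else
      (⨍⁻ x in Icc a b, ENNReal.ofReal (υ x) ∂volume) *
        (⨍⁻ x in Icc a b, ENNReal.ofReal (υ x) ^ (1 - Real.conjExponent p) ∂volume) ^ (p - 1)) a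
    (le_iSup_of_le b (le_iSup_of_le hab le_rfl))
  change _ ≤ K at hb
  -- The convention 0 · ∞ = 0 makes the A_p bound void when υ(Q) = 0, but then the left side
  -- vanishes. Otherwise the bound forces the second factor to be finite.
  by_cases hW : W = 0
  · rw [hW, mul_zero]; exact zero_le
  by_cases hp1 : p = 1
  · subst hp1
    rw [if_pos rfl, setLAverage_eq, Real.volume_Icc] at hb
    change W / L * essSup (fun x => (w x)⁻¹) (volume.restrict (Icc a b)) ≤ K at hb
    set s := essSup (fun x => (w x)⁻¹) (volume.restrict (Icc a b))
    have hs : s ≠ ∞ := by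
      intro hs
      rw [hs, ENNReal.mul_top (ENNReal.div_ne_zero.2 ⟨hW, hL⟩)] at hb
      exact hK.ne (top_le_iff.1 hb)
    have hWs : W * s ≤ K * L := by
      have : W / L * s * L ≤ K * L := by gcongr
      rwa [mul_right_comm, ENNReal.div_mul_cancel hL0 hL] at this
    simp only [ENNReal.rpow_one]
    have key : ∫⁻ x in Icc a b, ‖g x‖ₑ ≤ s * ∫⁻ x in Icc a b, ‖g x‖ₑ * w x := by
      rw [← lintegral_const_mul' _ _ hs]
      refine lintegral_mono_ae ?_
      filter_upwards [ENNReal.ae_le_essSup (μ := volume.restrict (Icc a b)) fun x => (w x)⁻¹]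
        with x hx
      have hx0 : w x ≠ 0 := by
        intro h
        rw [h, ENNReal.inv_zero] at hx
        exact hs (top_le_iff.1 hx)
      calc ‖g x‖ₑ = (w x)⁻¹ * (‖g x‖ₑ * w x) := by
            rw [mul_comm, mul_assoc, ENNReal.mul_inv_cancel hx0 (hwtop x), mul_one]
        _ ≤ s * (‖g x‖ₑ * w x) := by gcongr
    calc (∫⁻ x in Icc a b, ‖g x‖ₑ) * W ≤ (s * ∫⁻ x in Icc a b, ‖g x‖ₑ * w x) * W := by gcongr
      _ = W * s * ∫⁻ x in Icc a b, ‖g x‖ₑ * w x := by ring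
      _ ≤ _ := by gcongr
  · have hp' : 1 < p := lt_of_le_of_ne hp (Ne.symm hp1)
    have hc : p.HolderConjugate (Real.conjExponent p) := Real.HolderConjugate.conjExponent hp'
    set p' := Real.conjExponent p
    have hp0 : 0 < p := by linarith
    have hp'0 : 0 < p' := hc.symm.pos
    have hp'1 : 1 < p' := hc.symm.lt
    have e1 : p' = (p' - 1) * p := by
      have := hc.symm.sub_one_mul_conj
      linarith
    have e2 : p / p' = p - 1 := hc.div_conj_eq_sub_one
    rw [if_neg hp1, setLAverage_eq, setLAverage_eq, Real.volume_Icc] at hb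
    set S := ∫⁻ x in Icc a b, w x ^ (1 - p')
    change W / L * (S / L) ^ (p - 1) ≤ K at hb
    rw [mul_div_rpow_div hp hL0 hL, ENNReal.div_le_iff (by simp [hL0, hL]) (by simp [hL0, hL])] at hb
    have hS : S ≠ ∞ := by
      intro hS
      rw [hS, ENNReal.top_rpow_of_pos (by linarith), ENNReal.mul_top hW] at hb
      exact (ENNReal.mul_ne_top hK.ne (ENNReal.rpow_ne_top_of_nonneg hp0.le hL)) (top_le_iff.1 hb)
    have hwm : AEMeasurable w (volume.restrict (Icc a b)) := hw.restrict
    have hgm : AEMeasurable (fun x => ‖g x‖ₑ) (volume.restrict (Icc a b)) := hg.enorm.restrict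
    -- A negative power of 0 is ∞, so finiteness of S makes the weight positive a.e. and the
    -- factorization legitimate.
    have hpos : ∀ᵐ x ∂(volume.restrict (Icc a b)), w x ≠ 0 := by
      filter_upwards [ae_lt_top' (hwm.pow_const _) hS] with x hx h
      rw [h, ENNReal.zero_rpow_of_neg (by linarith)] at hx
      exact lt_irrefl _ hx
    have hold := ENNReal.lintegral_mul_le_Lp_mul_Lq (volume.restrict (Icc a b)) hc
      (f := fun x => ‖g x‖ₑ * w x ^ (1 / p)) (g := fun x => w x ^ (-(1 / p)))
      (hgm.mul (hwm.pow_const _)) (hwm.pow_const _)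
    have i1 : ∫⁻ x in Icc a b, ((fun x => ‖g x‖ₑ * w x ^ (1 / p)) * fun x => w x ^ (-(1 / p))) x =
        ∫⁻ x in Icc a b, ‖g x‖ₑ := by
      refine lintegral_congr_ae ?_
      filter_upwards [hpos] with x hx
      rw [Pi.mul_apply, mul_assoc, ← ENNReal.rpow_add _ _ hx (hwtop x), add_neg_cancel,
        ENNReal.rpow_zero, mul_one]
    have i2 : ∀ x, (‖g x‖ₑ * w x ^ (1 / p)) ^ p = ‖g x‖ₑ ^ p * w x := fun x => by
      rw [ENNReal.mul_rpow_of_nonneg _ _ hp0.le, ← ENNReal.rpow_mul, one_div,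
        inv_mul_cancel₀ hp0.ne', ENNReal.rpow_one]
    have i3 : ∀ x, (w x ^ (-(1 / p))) ^ p' = w x ^ (1 - p') := fun x => by
      rw [← ENNReal.rpow_mul]
      congr 1
      field_simp
      linarith
    simp_rw [i2, i3] at hold
    rw [i1] at hold
    have hpow : (∫⁻ x in Icc a b, ‖g x‖ₑ) ^ p ≤
        (∫⁻ x in Icc a b, ‖g x‖ₑ ^ p * w x) * S ^ (p - 1) := by
      calc _ ≤ ((∫⁻ x in Icc a b, ‖g x‖ₑ ^ p * w x) ^ (1 / p) * S ^ (1 / p')) ^ p := by gcongr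
        _ = _ := by
          rw [ENNReal.mul_rpow_of_nonneg _ _ hp0.le, ← ENNReal.rpow_mul, ← ENNReal.rpow_mul,
            one_div, inv_mul_cancel₀ hp0.ne', ENNReal.rpow_one, one_div_mul_eq_div, e2]
    calc (∫⁻ x in Icc a b, ‖g x‖ₑ) ^ p * W
        ≤ ((∫⁻ x in Icc a b, ‖g x‖ₑ ^ p * w x) * S ^ (p - 1)) * W := by gcongr
      _ = W * S ^ (p - 1) * ∫⁻ x in Icc a b, ‖g x‖ₑ ^ p * w x := by ring
      _ ≤ _ := by gcongr

/-! ### From tested averages back to the Muckenhoupt condition -/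

/-- The averaging inequality for nonnegative bounded functions supported in the interval. -/
def TestAvgBound (p : ℝ) (υ : ℝ → ℝ) (K : ℝ≥0∞) : Prop :=
  ∀ a b : ℝ, a < b → ∀ g : ℝ → ℝ, AEMeasurable g volume → (∀ x, 0 ≤ g x) →
    (∃ N, ∀ x, g x ≤ N) → (∀ x, x ∉ Icc a b → g x = 0) →
    (∫⁻ x, ‖g x‖ₑ) ^ p * ∫⁻ x in Icc a b, ENNReal.ofReal (υ x) ≤
      K * ENNReal.ofReal (b - a) ^ p * weightedEnergy p υ g

/-- The extremal test function is (υ + ε)^(1-p'), with ε keeping it bounded where υ is small. Since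
(1 - p')p + 1 = 1 - p', its energy is at most its own integral S, and dividing by S, which is
neither 0 nor ∞, leaves S^(p-1). -/
theorem TestAvgBound.rpow_bound {p : ℝ} (hp : 1 < p) {υ : ℝ → ℝ} (h0 : ∀ x, 0 ≤ υ x)
    (hl : LocallyIntegrable υ volume) {K : ℝ≥0∞} (h : TestAvgBound p υ K) {a b ε : ℝ} (hab : a < b)
    (hε : 0 < ε) :
    (∫⁻ x in Icc a b, ENNReal.ofReal (υ x + ε) ^ (1 - Real.conjExponent p)) ^ (p - 1) *
      ∫⁻ x in Icc a b, ENNReal.ofReal (υ x) ≤ K * ENNReal.ofReal (b - a) ^ p := by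
  have hc : p.HolderConjugate (Real.conjExponent p) := Real.HolderConjugate.conjExponent hp
  set p' := Real.conjExponent p
  have hp'1 : 1 < p' := hc.symm.lt
  have hυm : AEMeasurable υ volume := hl.aestronglyMeasurable.aemeasurable
  set ρ : ℝ → ℝ := fun x => (υ x + ε) ^ (1 - p')
  have hυε : ∀ x, 0 < υ x + ε := fun x => by have := h0 x; linarith
  have hρ0 : ∀ x, 0 < ρ x := fun x => Real.rpow_pos_of_pos (hυε x) _
  have hρe : ∀ x, ‖ρ x‖ₑ = ENNReal.ofReal (υ x + ε) ^ (1 - p') := fun x => by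
    rw [ENNReal.ofReal_rpow_of_pos (hυε x), Real.enorm_of_nonneg (hρ0 x).le]
  have hρN : ∀ x, ρ x ≤ ε ^ (1 - p') := fun x =>
    Real.rpow_le_rpow_of_nonpos hε (by have := h0 x; linarith) (by linarith)
  have hρm : AEMeasurable ρ volume := (hυm.add_const ε).pow_const _
  have hN0 : (0 : ℝ) ≤ ε ^ (1 - p') := (Real.rpow_pos_of_pos hε _).le
  have key := h a b hab ((Icc a b).indicator ρ) (hρm.indicator measurableSet_Icc)
    (fun x => indicator_nonneg (fun x _ => (hρ0 x).le) x)
    ⟨ε ^ (1 - p'), fun x => indicator_apply_le' (fun _ => hρN x) fun _ => hN0⟩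
    fun x hx => indicator_of_notMem hx _
  set S := ∫⁻ x in Icc a b, ENNReal.ofReal (υ x + ε) ^ (1 - p')
  have hS1 : ∫⁻ x, ‖(Icc a b).indicator ρ x‖ₑ = S := by
    simp only [S]
    rw [← lintegral_indicator measurableSet_Icc]
    refine lintegral_congr fun x => ?_
    rw [enorm_indicator_eq_indicator_enorm]
    simp_rw [hρe]
  have hE : weightedEnergy p υ ((Icc a b).indicator ρ) ≤ S := by
    simp only [S]
    rw [weightedEnergy, ← lintegral_indicator measurableSet_Icc]
    refine lintegral_mono fun x => ?_
    by_cases hx : x ∈ Icc a b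
    · simp only [indicator_of_mem hx]
      rw [hρe, ← ENNReal.rpow_mul]
      have hne : ENNReal.ofReal (υ x + ε) ≠ 0 := by simp [hυε x]
      calc ENNReal.ofReal (υ x + ε) ^ ((1 - p') * p) * ENNReal.ofReal (υ x)
          ≤ ENNReal.ofReal (υ x + ε) ^ ((1 - p') * p) * ENNReal.ofReal (υ x + ε) ^ (1 : ℝ) := by
            rw [ENNReal.rpow_one]
            gcongr
            linarith
        _ = _ := by
            rw [← ENNReal.rpow_add _ _ hne ENNReal.ofReal_ne_top]
            congr 1
            have := hc.symm.sub_one_mul_conj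
            linarith
    · simp only [indicator_of_notMem hx]
      rw [enorm_zero, ENNReal.zero_rpow_of_pos (by linarith), zero_mul]
  have hS0 : S ≠ 0 := by
    intro hS
    have hm : AEMeasurable (fun x => ENNReal.ofReal (υ x + ε) ^ (1 - p'))
      (volume.restrict (Icc a b)) := ((hυm.add_const ε).ennreal_ofReal.pow_const _).restrict
    have := (lintegral_eq_zero_iff' hm).1 hS
    have hcontra : ∀ᵐ _x ∂(volume.restrict (Icc a b)), False := by
      filter_upwards [this] with x hx
      rw [← hρe, Pi.zero_apply, enorm_eq_zero] at hx
      exact (hρ0 x).ne' hx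
    rw [Filter.eventually_false_iff_eq_bot, ae_eq_bot, Measure.restrict_eq_zero, Real.volume_Icc,
      ENNReal.ofReal_eq_zero] at hcontra
    linarith
  have hS : S ≠ ∞ := by
    refine ne_top_of_le_ne_top (b := ENNReal.ofReal (ε ^ (1 - p')) * volume (Icc a b)) ?_ ?_
    · exact ENNReal.mul_ne_top ENNReal.ofReal_ne_top (by simp)
    · rw [← setLIntegral_const]
      refine lintegral_mono fun x => ?_
      rw [ENNReal.ofReal_rpow_of_pos (hυε x)]
      exact ENNReal.ofReal_le_ofReal (hρN x)
  rw [hS1] at key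
  have hSp : S ^ p = S * S ^ (p - 1) := by
    conv_lhs => rw [show p = 1 + (p - 1) by ring, ENNReal.rpow_add _ _ hS0 hS, ENNReal.rpow_one]
  refine (ENNReal.mul_le_mul_iff_right hS0 hS).1 ?_
  calc S * (S ^ (p - 1) * ∫⁻ x in Icc a b, ENNReal.ofReal (υ x))
      = S ^ p * ∫⁻ x in Icc a b, ENNReal.ofReal (υ x) := by rw [hSp]; ring
    _ ≤ K * ENNReal.ofReal (b - a) ^ p * S := key.trans (by gcongr)
    _ = _ := mul_comm _ _

/-- Let A be the average of υ and E the part of the interval where υ < A/K. If |E| > 0, testing with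
the indicator of E gives |E| υ(Q) ≤ K |Q| υ(E) < |Q| A |E| = |E| υ(Q), which is absurd. Hence 1/υ ≤
K/A a.e. -/
theorem TestAvgBound.essSup_bound {υ : ℝ → ℝ}
    (hl : LocallyIntegrable υ volume) {K : ℝ≥0∞} (hK0 : K ≠ 0) (hK : K ≠ ∞)
    (h : TestAvgBound 1 υ K) {a b : ℝ} (hab : a < b) :
    (⨍⁻ x in Icc a b, ENNReal.ofReal (υ x) ∂volume) *
        essSup (fun x => (ENNReal.ofReal (υ x))⁻¹) (volume.restrict (Icc a b)) ≤ K := by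
  rw [setLAverage_eq, Real.volume_Icc]
  set W := ∫⁻ x in Icc a b, ENNReal.ofReal (υ x)
  set L := ENNReal.ofReal (b - a)
  have hL0 : L ≠ 0 := by simp [L, hab]
  have hL : L ≠ ∞ := ENNReal.ofReal_ne_top
  by_cases hW : W = 0
  · rw [hW, ENNReal.zero_div, zero_mul]; exact zero_le
  have hWt : W ≠ ∞ := by
    have := (hl.integrableOn_isCompact (isCompact_Icc (a := a) (b := b))).lintegral_lt_top
    exact this.ne
  set A := W / L
  have hA0 : A ≠ 0 := ENNReal.div_ne_zero.2 ⟨hW, hL⟩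
  have hA : A ≠ ∞ := ENNReal.div_ne_top hWt hL0
  have hυm := hl.aestronglyMeasurable.aemeasurable
  set υ' := hυm.mk υ
  have hυ' : Measurable υ' := hυm.measurable_mk
  have hee : υ =ᵐ[volume] υ' := hυm.ae_eq_mk
  set E : Set ℝ := Icc a b ∩ {x | ENNReal.ofReal (υ' x) < A / K}
  have hEm : MeasurableSet E :=
    measurableSet_Icc.inter (measurableSet_lt hυ'.ennreal_ofReal measurable_const)
  have hE0 : volume E = 0 := by
    by_contra hE
    have hEt : volume E ≠ ∞ := ne_top_of_le_ne_top (by simp : volume (Icc a b) ≠ ∞)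
      (measure_mono inter_subset_left)
    have key := h a b hab (E.indicator fun _ => 1) (measurable_const.indicator hEm).aemeasurable
      (fun x => indicator_nonneg (fun _ _ => zero_le_one) x)
      ⟨1, fun x => indicator_apply_le' (fun _ => le_rfl) fun _ => zero_le_one⟩
      fun x hx => indicator_of_notMem (fun hE => hx hE.1) _
    have i1 : ∫⁻ x, ‖E.indicator (fun _ => (1 : ℝ)) x‖ₑ = volume E := by
      simp_rw [enorm_indicator_eq_indicator_enorm]
      rw [lintegral_indicator hEm]
      simp
    have i2 : weightedEnergy 1 υ (E.indicator fun _ => 1) =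
        ∫⁻ x in E, ENNReal.ofReal (υ' x) := by
      rw [weightedEnergy, ← lintegral_indicator hEm]
      refine lintegral_congr_ae ?_
      filter_upwards [hee] with x hx
      by_cases hxE : x ∈ E <;> simp [hxE, hx]
    rw [i1, i2, ENNReal.rpow_one, ENNReal.rpow_one] at key
    have strict : ∫⁻ x in E, ENNReal.ofReal (υ' x) < ∫⁻ _ in E, A / K := by
      refine setLIntegral_strict_mono hEm hE measurable_const ?_
        (Filter.Eventually.of_forall fun x hx => hx.2)
      refine ne_top_of_le_ne_top (b := ∫⁻ _ in E, A / K) ?_ ?_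
      · rw [setLIntegral_const]
        exact ENNReal.mul_ne_top (ENNReal.div_ne_top hA hK0) hEt
      · exact setLIntegral_mono' hEm fun x hx => hx.2.le
    rw [setLIntegral_const] at strict
    have hKL0 : K * L ≠ 0 := mul_ne_zero hK0 hL0
    have hKL : K * L ≠ ∞ := ENNReal.mul_ne_top hK hL
    have h2 := (ENNReal.mul_lt_mul_iff_right hKL0 hKL).2 strict
    have e : K * L * (A / K * volume E) = volume E * W := by
      have e1 : K * (A / K) = A := ENNReal.mul_div_cancel hK0 hK
      have e2 : L * A = W := ENNReal.mul_div_cancel hL0 hL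
      calc _ = (L * (K * (A / K))) * volume E := by ring
        _ = _ := by rw [e1, e2, mul_comm]
    rw [e] at h2
    exact absurd key (not_le.2 h2)
  have hess : essSup (fun x => (ENNReal.ofReal (υ x))⁻¹) (volume.restrict (Icc a b)) ≤ K / A := by
    refine essSup_le_of_ae_le _ ?_
    rw [Filter.EventuallyLE, ae_restrict_iff' measurableSet_Icc]
    have hn : ∀ᵐ x, x ∉ E := measure_eq_zero_iff_ae_notMem.1 hE0
    filter_upwards [hn, hee] with x hx hx' hxI
    rw [hx', ← ENNReal.inv_div (Or.inl hK) (Or.inl hK0)]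
    rw [ENNReal.inv_le_inv]
    by_contra hlt
    exact hx ⟨hxI, not_le.1 hlt⟩
  calc A * _ ≤ A * (K / A) := by gcongr
    _ = K := ENNReal.mul_div_cancel hA0 hA

theorem TestAvgBound.isAp {p : ℝ} (hp : 1 ≤ p) {υ : ℝ → ℝ} (h0 : ∀ x, 0 ≤ υ x)
    (hl : LocallyIntegrable υ volume) {K : ℝ≥0∞} (hK0 : K ≠ 0) (hK : K ≠ ∞)
    (h : TestAvgBound p υ K) : IsAp p υ := by
  refine ⟨h0, hl, lt_of_le_of_lt (iSup_le fun a => iSup_le fun b => iSup_le fun hab => ?_)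
    (lt_top_iff_ne_top.2 hK)⟩
  split_ifs with hp1
  · subst hp1
    exact h.essSup_bound hl hK0 hK hab
  have hp' : 1 < p := lt_of_le_of_ne hp (Ne.symm hp1)
  have hp0 : 0 < p := by linarith
  have hp'1 : 1 < Real.conjExponent p := (Real.HolderConjugate.conjExponent hp').symm.lt
  set p' := Real.conjExponent p
  rw [setLAverage_eq, setLAverage_eq, Real.volume_Icc]
  have hL0 : ENNReal.ofReal (b - a) ≠ 0 := by simp [hab]
  have hL : ENNReal.ofReal (b - a) ≠ ∞ := ENNReal.ofReal_ne_top
  rw [mul_div_rpow_div hp hL0 hL, ENNReal.div_le_iff (by simp [hL0, hL])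
    (by simp [hL0, hL])]
  have hW : ∫⁻ x in Icc a b, ENNReal.ofReal (υ x) ≠ ∞ :=
    (hl.integrableOn_isCompact (isCompact_Icc (a := a) (b := b))).lintegral_lt_top.ne
  have hυm : AEMeasurable υ volume := hl.aestronglyMeasurable.aemeasurable
  -- As ε decreases to 0 the powers increase, because 1 - p' < 0, so monotone convergence removes ε,
  -- including where υ vanishes.
  have hlim : Filter.Tendsto (fun n : ℕ => ∫⁻ x in Icc a b,
      ENNReal.ofReal (υ x + 1 / ((n : ℝ) + 1)) ^ (1 - p')) Filter.atTop
      (nhds (∫⁻ x in Icc a b, ENNReal.ofReal (υ x) ^ (1 - p'))) := by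
    refine lintegral_tendsto_of_tendsto_of_monotone
      (fun n => ((hυm.add_const _).ennreal_ofReal.pow_const _).restrict)
      (Filter.Eventually.of_forall fun x m n hmn => ?_) (Filter.Eventually.of_forall fun x => ?_)
    · have h1 : ENNReal.ofReal (υ x + 1 / ((n : ℝ) + 1)) ≤
          ENNReal.ofReal (υ x + 1 / ((m : ℝ) + 1)) := ENNReal.ofReal_le_ofReal (by gcongr)
      dsimp only
      rw [← neg_sub p' 1, ENNReal.rpow_neg, ENNReal.rpow_neg]
      exact ENNReal.inv_le_inv.2 (ENNReal.rpow_le_rpow h1 (by linarith))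
    · refine (ENNReal.continuous_rpow_const.tendsto _).comp
        ((ENNReal.continuous_ofReal.tendsto _).comp ?_)
      simpa using tendsto_one_div_add_atTop_nhds_zero_nat.const_add (υ x)
  have hlim2 := ENNReal.Tendsto.mul_const (b := ∫⁻ x in Icc a b, ENNReal.ofReal (υ x))
    ((ENNReal.continuous_rpow_const (y := p - 1)).tendsto _ |>.comp hlim) (Or.inr hW)
  rw [mul_comm]
  exact le_of_tendsto hlim2 (Filter.Eventually.of_forall fun n =>
    h.rpow_bound hp' h0 hl hab (by positivity))

/-! ### The maximal radius function -/

/-- The supremum of the radii of all balls of the family `F` that contain `x`. -/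
def maxRadius (F : Set (ℝ × ℝ)) (x : ℝ) : ℝ≥0∞ :=
  ⨆ i ∈ F, (Metric.ball i.1 i.2).indicator (fun _ => ENNReal.ofReal i.2) x

/-- Open balls make each indicator lower semicontinuous, and this survives arbitrary, even
uncountable, suprema. -/
theorem measurable_maxRadius (F : Set (ℝ × ℝ)) : Measurable (maxRadius F) := by
  refine LowerSemicontinuous.measurable ?_
  exact lowerSemicontinuous_biSup fun i _ =>
    Metric.isOpen_ball.lowerSemicontinuous_indicator zero_le

theorem le_maxRadius {F : Set (ℝ × ℝ)} {c r x : ℝ} (h : (c, r) ∈ F) (hx : x ∈ Metric.ball c r) :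
    ENNReal.ofReal r ≤ maxRadius F x := by
  refine le_iSup₂_of_le (c, r) h ?_
  rw [indicator_of_mem hx]

/-- The balls `B(c,r)` with `t r² < ∫_{B(c,r)} |g|`. -/
def heavyBalls (t : ℝ) (g : ℝ → ℝ) : Set (ℝ × ℝ) :=
  {i | 0 < i.2 ∧ ENNReal.ofReal (t * i.2 ^ 2) < ∫⁻ y in Metric.closedBall i.1 i.2, ‖g y‖ₑ}

/-- The averaging inequality on 5B for g restricted to B reads (∫_B |g|)^p υ(5B) ≤ K (10r)^p ∫_B
|g|^p υ. Heaviness bounds the left factor below by t^p r^(2p), so one r^p cancels; 50 = 5 · 10. -/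
theorem AvgBound.heavyBall_le {p : ℝ} (hp : 1 ≤ p) {υ : ℝ → ℝ} {K : ℝ≥0∞} (hK : AvgBound p υ K)
    {g : ℝ → ℝ} (hg : AEMeasurable g volume) {t : ℝ} (ht : 0 < t) {c r : ℝ}
    (h : (c, r) ∈ heavyBalls t g) :
    ENNReal.ofReal (t ^ p) * (ENNReal.ofReal (5 * r) ^ p *
      ∫⁻ x in Metric.closedBall c (5 * r), ENNReal.ofReal (υ x)) ≤
      K * 50 ^ p * ∫⁻ x in Metric.closedBall c r, ‖g x‖ₑ ^ p * ENNReal.ofReal (υ x) := by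
  obtain ⟨hr, hh⟩ := h
  dsimp only at hr hh
  have hp0 : 0 < p := by linarith
  have hsub : Metric.closedBall c r ⊆ Icc (c - 5 * r) (c + 5 * r) := by
    rw [Real.closedBall_eq_Icc]
    exact Icc_subset_Icc (by linarith) (by linarith)
  have key := hK (c - 5 * r) (c + 5 * r) (by linarith) ((Metric.closedBall c r).indicator g)
    (hg.indicator Metric.isClosed_closedBall.measurableSet)
  have i1 : ∫⁻ x in Icc (c - 5 * r) (c + 5 * r), ‖(Metric.closedBall c r).indicator g x‖ₑ =
      ∫⁻ x in Metric.closedBall c r, ‖g x‖ₑ := by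
    simp_rw [enorm_indicator_eq_indicator_enorm]
    rw [setLIntegral_indicator Metric.isClosed_closedBall.measurableSet, inter_eq_left.2 hsub]
  have i2 : ∫⁻ x in Icc (c - 5 * r) (c + 5 * r), ‖(Metric.closedBall c r).indicator g x‖ₑ ^ p *
      ENNReal.ofReal (υ x) =
      ∫⁻ x in Metric.closedBall c r, ‖g x‖ₑ ^ p * ENNReal.ofReal (υ x) := by
    have : ∀ x, ‖(Metric.closedBall c r).indicator g x‖ₑ ^ p * ENNReal.ofReal (υ x) =
        (Metric.closedBall c r).indicator (fun x => ‖g x‖ₑ ^ p * ENNReal.ofReal (υ x)) x := by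
      intro x
      by_cases hx : x ∈ Metric.closedBall c r
      · simp only [indicator_of_mem hx]
      · simp only [indicator_of_notMem hx]
        rw [enorm_zero, ENNReal.zero_rpow_of_pos hp0, zero_mul]
    simp_rw [this]
    rw [setLIntegral_indicator Metric.isClosed_closedBall.measurableSet, inter_eq_left.2 hsub]
  rw [i1, i2, ← Real.closedBall_eq_Icc] at key
  set W := ∫⁻ x in Metric.closedBall c (5 * r), ENNReal.ofReal (υ x)
  set G := ∫⁻ x in Metric.closedBall c r, ‖g x‖ₑ ^ p * ENNReal.ofReal (υ x)
  set ρ := ENNReal.ofReal r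
  have hρ0 : ρ ^ p ≠ 0 := by
    have : ρ ≠ 0 := by simp [ρ, hr]
    simp [this, ρ]
  have hρ : ρ ^ p ≠ ∞ := ENNReal.rpow_ne_top_of_nonneg hp0.le ENNReal.ofReal_ne_top
  have h5 : ENNReal.ofReal (5 * r) ^ p = 5 ^ p * ρ ^ p := by
    rw [ENNReal.ofReal_mul (by norm_num), ENNReal.mul_rpow_of_nonneg _ _ hp0.le,
      ENNReal.ofReal_ofNat]
  have h10 : ENNReal.ofReal (c + 5 * r - (c - 5 * r)) ^ p = 10 ^ p * ρ ^ p := by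
    rw [show c + 5 * r - (c - 5 * r) = 10 * r by ring, ENNReal.ofReal_mul (by norm_num),
      ENNReal.mul_rpow_of_nonneg _ _ hp0.le, ENNReal.ofReal_ofNat]
  have h50 : (50 : ℝ≥0∞) ^ p = 5 ^ p * 10 ^ p := by
    rw [← ENNReal.mul_rpow_of_nonneg _ _ hp0.le]
    norm_num
  have htr : ENNReal.ofReal (t ^ p) * (ρ ^ p * ρ ^ p) ≤
      (∫⁻ x in Metric.closedBall c r, ‖g x‖ₑ) ^ p := by
    have : ENNReal.ofReal (t ^ p) * (ρ ^ p * ρ ^ p) = ENNReal.ofReal (t * r ^ 2) ^ p := by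
      rw [← ENNReal.ofReal_rpow_of_pos ht, ← ENNReal.mul_rpow_of_nonneg _ _ hp0.le,
        ← ENNReal.mul_rpow_of_nonneg _ _ hp0.le, ENNReal.ofReal_mul ht.le, sq,
        ENNReal.ofReal_mul hr.le]
    rw [this]
    exact ENNReal.rpow_le_rpow hh.le hp0.le
  rw [h10] at key
  rw [h5, h50]
  refine (ENNReal.mul_le_mul_iff_right hρ0 hρ).1 ?_
  calc ρ ^ p * (ENNReal.ofReal (t ^ p) * (5 ^ p * ρ ^ p * W))
      = 5 ^ p * ((ENNReal.ofReal (t ^ p) * (ρ ^ p * ρ ^ p)) * W) := by ring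
    _ ≤ 5 ^ p * (K * (10 ^ p * ρ ^ p) * G) := by
        gcongr 5 ^ p * ?_
        exact le_trans (by gcongr) key
    _ = _ := by ring

/-- Vitali selects disjoint balls whose fivefold enlargements contain every ball of the family. So
M^p is at most the sum of (5r)^p over the selected balls with x in 5B, and the energies on the
disjoint balls add up to at most the total. The covering lemma needs bounded radii, hence R. -/
theorem AvgBound.maxRadius_bounded {p : ℝ} (hp : 1 ≤ p) {υ : ℝ → ℝ}
    (hυm : AEMeasurable υ volume) {K : ℝ≥0∞} (hK : AvgBound p υ K)
    {g : ℝ → ℝ} (hg : AEMeasurable g volume) {t : ℝ} (ht : 0 < t) {F : Set (ℝ × ℝ)}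
    (hF : F ⊆ heavyBalls t g) {R : ℝ} (hR : ∀ i ∈ F, i.2 ≤ R) :
    ENNReal.ofReal (t ^ p) * ∫⁻ x, maxRadius F x ^ p * ENNReal.ofReal (υ x) ≤
      K * 50 ^ p * weightedEnergy p υ g := by
  have hp0 : 0 < p := by linarith
  obtain ⟨u, huF, hdisj, hcov⟩ := Vitali.exists_disjoint_subfamily_covering_enlargement_closedBall
    F (fun i => i.1) (fun i => i.2) R hR 5 (by norm_num)
  have hupos : ∀ b ∈ u, 0 < b.2 := fun b hb => (hF (huF hb)).1
  have hcount : u.Countable := by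
    refine hdisj.countable_of_nonempty_interior fun b hb => ?_
    rw [interior_closedBall _ (hupos b hb).ne']
    exact Metric.nonempty_ball.2 (hupos b hb)
  have : Countable u := hcount.to_subtype
  set T : ℝ × ℝ → ℝ → ℝ≥0∞ := fun b =>
    (Metric.closedBall b.1 (5 * b.2)).indicator fun _ => ENNReal.ofReal (5 * b.2) ^ p
  have hpt : ∀ x, maxRadius F x ^ p ≤ ∑' b : u, T b x := by
    intro x
    rw [← ENNReal.le_rpow_inv_iff hp0]
    refine iSup₂_le fun i hi => ?_
    by_cases hx : x ∈ Metric.ball i.1 i.2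
    · rw [indicator_of_mem hx, ENNReal.le_rpow_inv_iff hp0]
      obtain ⟨b, hb, hsub⟩ := hcov i hi
      refine le_trans ?_ (ENNReal.le_tsum (⟨b, hb⟩ : u))
      simp only [T]
      rw [indicator_of_mem (hsub (Metric.ball_subset_closedBall hx))]
      have hi0 : 0 < i.2 := (hF hi).1
      -- Inclusion of intervals compares the radii as well.
      have hle : i.2 ≤ 5 * b.2 := by
        rw [Real.closedBall_eq_Icc, Real.closedBall_eq_Icc,
          Icc_subset_Icc_iff (by linarith)] at hsub
        linarith [hsub.1, hsub.2]
      gcongr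
    · rw [indicator_of_notMem hx]
      exact zero_le
  have hwm : AEMeasurable (fun x => ENNReal.ofReal (υ x)) volume := hυm.ennreal_ofReal
  calc ENNReal.ofReal (t ^ p) * ∫⁻ x, maxRadius F x ^ p * ENNReal.ofReal (υ x)
      ≤ ENNReal.ofReal (t ^ p) * ∫⁻ x, ∑' b : u, T b x * ENNReal.ofReal (υ x) := by
        gcongr with x
        rw [ENNReal.tsum_mul_right]
        gcongr
        exact hpt x
    _ = ∑' b : u, ENNReal.ofReal (t ^ p) * (ENNReal.ofReal (5 * b.1.2) ^ p *
          ∫⁻ x in Metric.closedBall b.1.1 (5 * b.1.2), ENNReal.ofReal (υ x)) := by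
        rw [lintegral_tsum, ENNReal.tsum_mul_left]
        · congr 1
          refine tsum_congr fun b => ?_
          have hm : MeasurableSet (Metric.closedBall b.1.1 (5 * b.1.2)) :=
            Metric.isClosed_closedBall.measurableSet
          rw [← lintegral_const_mul' _ _
            (ENNReal.rpow_ne_top_of_nonneg hp0.le ENNReal.ofReal_ne_top),
            ← lintegral_indicator hm]
          refine lintegral_congr fun x => ?_
          simp only [T]
          by_cases hx : x ∈ Metric.closedBall b.1.1 (5 * b.1.2)
          · rw [indicator_of_mem hx, indicator_of_mem hx]
          · rw [indicator_of_notMem hx, indicator_of_notMem hx, zero_mul]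
        · intro b
          exact (measurable_const.indicator
            Metric.isClosed_closedBall.measurableSet).aemeasurable.mul hwm
    _ ≤ ∑' b : u, K * 50 ^ p *
          ∫⁻ x in Metric.closedBall b.1.1 b.1.2, ‖g x‖ₑ ^ p * ENNReal.ofReal (υ x) :=
        ENNReal.tsum_le_tsum fun b => hK.heavyBall_le hp hg ht (hF (huF b.2))
    _ = K * 50 ^ p * ∫⁻ x in ⋃ b ∈ u, Metric.closedBall b.1 b.2,
          ‖g x‖ₑ ^ p * ENNReal.ofReal (υ x) := by
        rw [ENNReal.tsum_mul_left, lintegral_biUnion hcount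
          (fun _ _ => Metric.isClosed_closedBall.measurableSet) hdisj]
    _ ≤ _ := by
        gcongr
        exact setLIntegral_le_lintegral _ _

/-- The bound for radii at most n does not depend on n, so monotone convergence applies. -/
theorem AvgBound.maxRadius_heavyBalls {p : ℝ} (hp : 1 ≤ p) {υ : ℝ → ℝ}
    (hυm : AEMeasurable υ volume) {K : ℝ≥0∞} (hK : AvgBound p υ K)
    {g : ℝ → ℝ} (hg : AEMeasurable g volume) {t : ℝ} (ht : 0 < t) :
    ENNReal.ofReal (t ^ p) *
      ∫⁻ x, maxRadius (heavyBalls t g) x ^ p * ENNReal.ofReal (υ x) ≤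
      K * 50 ^ p * weightedEnergy p υ g := by
  have hp0 : 0 < p := by linarith
  set F : ℕ → Set (ℝ × ℝ) := fun n => heavyBalls t g ∩ {i | i.2 ≤ n}
  have hmono : ∀ x, Monotone fun n => maxRadius (F n) x := fun x m n hmn =>
    biSup_mono fun i hi => ⟨hi.1, le_trans (show i.2 ≤ m from hi.2) (Nat.cast_le.2 hmn)⟩
  have hsup : ∀ x, ⨆ n, maxRadius (F n) x = maxRadius (heavyBalls t g) x := by
    intro x
    refine le_antisymm (iSup_le fun n => biSup_mono fun i hi => hi.1) (iSup₂_le fun i hi => ?_)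
    obtain ⟨n, hn⟩ := exists_nat_ge i.2
    exact le_iSup_of_le n (le_iSup₂_of_le (f := fun i (_ : i ∈ F n) =>
      (Metric.ball i.1 i.2).indicator (fun _ => ENNReal.ofReal i.2) x) i ⟨hi, hn⟩ le_rfl)
  have hlim : Filter.Tendsto (fun n => ∫⁻ x, maxRadius (F n) x ^ p * ENNReal.ofReal (υ x))
      Filter.atTop (nhds (∫⁻ x, maxRadius (heavyBalls t g) x ^ p * ENNReal.ofReal (υ x))) := by
    refine lintegral_tendsto_of_tendsto_of_monotone
      (fun n => ((measurable_maxRadius _).pow_const p).aemeasurable.mul hυm.ennreal_ofReal)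
      (Filter.Eventually.of_forall fun x m n hmn => ?_) (Filter.Eventually.of_forall fun x => ?_)
    · dsimp only
      gcongr
      exact hmono x hmn
    · refine ENNReal.Tendsto.mul_const ?_ (Or.inr ENNReal.ofReal_ne_top)
      refine (ENNReal.continuous_rpow_const.tendsto _).comp ?_
      rw [← hsup x]
      exact tendsto_atTop_iSup (hmono x)
  have hlim2 := ENNReal.Tendsto.const_mul (a := ENNReal.ofReal (t ^ p)) hlim
    (Or.inr ENNReal.ofReal_ne_top)
  exact le_of_tendsto hlim2 (Filter.Eventually.of_forall fun n =>
    hK.maxRadius_bounded hp hυm hg ht inter_subset_left fun i hi => hi.2)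

/-! ### Sufficiency of the Muckenhoupt condition -/

theorem exists_ofReal_ge {A : ℝ≥0∞} (hA : A ≠ ∞) : ∃ C : ℝ, 0 < C ∧ A ≤ ENNReal.ofReal C := by
  refine ⟨A.toReal + 1, by positivity, ?_⟩
  rw [← ENNReal.ofReal_toReal hA]
  exact ENNReal.ofReal_le_ofReal (by simp)

theorem lintegral_abs_rpow_le {q : ℝ} (hq : 0 < q) (M : ℝ≥0∞) :
    ∫⁻ h in {h : ℝ | ENNReal.ofReal |h| ≤ M}, ENNReal.ofReal (|h| ^ (q - 1)) ≤
      ENNReal.ofReal (2 / q) * M ^ q := by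
  rcases eq_or_ne M ∞ with rfl | hM
  · rw [ENNReal.top_rpow_of_pos hq, ENNReal.mul_top (by simp [hq])]
    exact le_top
  set m := M.toReal
  have hm : 0 ≤ m := ENNReal.toReal_nonneg
  have hMm : M = ENNReal.ofReal m := (ENNReal.ofReal_toReal hM).symm
  have hpos : ∫⁻ h in Icc 0 m, ENNReal.ofReal (|h| ^ (q - 1)) = ENNReal.ofReal (m ^ q / q) := by
    have hi : IntegrableOn (fun h : ℝ => h ^ (q - 1)) (Ioc 0 m) volume :=
      (intervalIntegral.intervalIntegrable_rpow' (by linarith)).1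
    have h1 := integral_rpow (a := 0) (b := m) (r := q - 1) (Or.inl (by linarith))
    rw [sub_add_cancel, Real.zero_rpow hq.ne', sub_zero, intervalIntegral.integral_of_le hm] at h1
    rw [← h1, ofReal_integral_eq_lintegral_ofReal hi]
    · rw [setLIntegral_congr Ioc_ae_eq_Icc.symm]
      refine setLIntegral_congr_fun measurableSet_Ioc fun x hx => ?_
      rw [abs_of_pos hx.1]
    · filter_upwards [ae_restrict_mem measurableSet_Ioc] with x hx
      exact Real.rpow_nonneg hx.1.le _
  have hneg : ∫⁻ h in Icc (-m) 0, ENNReal.ofReal (|h| ^ (q - 1)) =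
      ∫⁻ h in Icc 0 m, ENNReal.ofReal (|h| ^ (q - 1)) := by
    have := (Measure.measurePreserving_neg (volume : Measure ℝ)).setLIntegral_comp_preimage_emb
      (MeasurableEquiv.neg ℝ).measurableEmbedding
      (fun h : ℝ => ENNReal.ofReal (|h| ^ (q - 1))) (Icc 0 m)
    simpa using this
  calc ∫⁻ h in {h : ℝ | ENNReal.ofReal |h| ≤ M}, ENNReal.ofReal (|h| ^ (q - 1))
      ≤ ∫⁻ h in Icc (-m) 0 ∪ Icc 0 m, ENNReal.ofReal (|h| ^ (q - 1)) := by
        refine lintegral_mono_set fun h hh => ?_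
        rw [Icc_union_Icc_eq_Icc (by linarith) hm, mem_Icc, ← abs_le]
        rw [mem_ofPred_eq, hMm] at hh
        exact (ENNReal.ofReal_le_ofReal_iff hm).1 hh
    _ ≤ ENNReal.ofReal (m ^ q / q) + ENNReal.ofReal (m ^ q / q) := by
        refine (lintegral_union_le _ _ _).trans ?_
        rw [hneg, hpos]
    _ = ENNReal.ofReal (2 / q) * M ^ q := by
        have h1 : 0 ≤ m ^ q / q := by positivity
        rw [← ENNReal.ofReal_add h1 h1, hMm, ENNReal.ofReal_rpow_of_nonneg hm hq.le,
          ← ENNReal.ofReal_mul (by positivity)]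
        congr 1
        ring

/-- With b = 1 the threshold t |h|^(k+1) exceeds the factor |h|^(k-1) of the difference bound by
exactly |h|², which is the heaviness condition at radius k|h| with level t/k². -/
theorem mem_heavyBalls_of_mem_levelSet {k : ℕ} (hk : 1 ≤ k) {f g : ℝ → ℝ} {t x h : ℝ} (ht : 0 < t)
    (hb : ‖diff k h f x‖ₑ ≤
      ENNReal.ofReal |h| ^ (k - 1) * ∫⁻ y in Metric.closedBall x (k * |h|), ‖g y‖ₑ)
    (hx : (x, h) ∈ levelSet t 1 k f) : (x, k * |h|) ∈ heavyBalls (t / k ^ 2) g := by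
  obtain ⟨hh0, hlt⟩ := hx
  dsimp only at hh0 hlt
  have hh : 0 < |h| := abs_pos.2 hh0
  have hk0 : (0 : ℝ) < k := by exact_mod_cast hk
  refine ⟨by positivity, ?_⟩
  dsimp only
  have e1 : t / (k : ℝ) ^ 2 * (k * |h|) ^ 2 = t * |h| ^ 2 := by field_simp
  have e2 : t * |h| ^ ((k : ℝ) + 1) = |h| ^ (k - 1) * (t * |h| ^ 2) := by
    rw [show ((k : ℝ) + 1) = ((k - 1 + 2 : ℕ) : ℝ) by
      push_cast [Nat.cast_sub hk]; ring, Real.rpow_natCast, pow_add]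
    ring
  rw [e1]
  have h1 : ENNReal.ofReal |h| ^ (k - 1) * ENNReal.ofReal (t * |h| ^ 2) < ENNReal.ofReal |h| ^ (k - 1) *
      ∫⁻ y in Metric.closedBall x (k * |h|), ‖g y‖ₑ := by
    refine lt_of_lt_of_le ?_ hb
    rw [← ENNReal.ofReal_pow hh.le, ← ENNReal.ofReal_mul (by positivity), ← e2,
      ← ofReal_norm, Real.norm_eq_abs]
    exact (ENNReal.ofReal_lt_ofReal_iff ((by positivity : 0 ≤ t * |h| ^ ((k : ℝ) + 1)).trans_lt hlt)).2 hlt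
  exact lt_of_mul_lt_mul_left' h1

/-- For almost every x, the slice of the level set lies, up to a null set of h, in |h| ≤ M(x). The
inner integral is thus at most (2/q) M^q, and its power p/q is a multiple of M^p. -/
theorem IsAp.bsvyFunctional_le {k : ℕ} (hk : 1 ≤ k) {p : ℝ} (hp : 1 ≤ p) {q : ℝ} (hq : 0 < q)
    {υ : ℝ → ℝ} (h : IsAp p υ) : ∃ C : ℝ, 0 < C ∧
      ∀ f g : ℝ → ℝ, MemHomSobolev k p υ f → IsWeakDeriv k f g →
        bsvyFunctional k p q q υ f ≤ ENNReal.ofReal C * weightedEnergy p υ g := by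
  have hp0 : 0 < p := by linarith
  have hk0 : (0 : ℝ) < k := by exact_mod_cast hk
  have hA : ENNReal.ofReal (2 / q) ^ (p / q) * ENNReal.ofReal (((k : ℝ) ^ 2) ^ p) *
      (apConst p υ * 50 ^ p) ≠ ∞ :=
    ENNReal.mul_ne_top (ENNReal.mul_ne_top
      (ENNReal.rpow_ne_top_of_nonneg (by positivity) ENNReal.ofReal_ne_top) ENNReal.ofReal_ne_top)
      (ENNReal.mul_ne_top h.2.2.ne (ENNReal.rpow_ne_top_of_nonneg hp0.le (by norm_num)))
  obtain ⟨C, hC, hAC⟩ := exists_ofReal_ge hA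
  refine ⟨C, hC, fun f g hf hg => iSup₂_le fun t ht => ?_⟩
  have hυm : AEMeasurable υ volume := h.2.1.aestronglyMeasurable.aemeasurable
  set M := maxRadius (heavyBalls (t / (k : ℝ) ^ 2) g)
  have ht' : 0 < t / (k : ℝ) ^ 2 := by positivity
  have hmain := (h.avgBound hp).maxRadius_heavyBalls hp hυm hg.1.aestronglyMeasurable.aemeasurable ht'
  have hc1 : ENNReal.ofReal (2 / q) ^ (p / q) ≠ ∞ :=
    ENNReal.rpow_ne_top_of_nonneg (by positivity) ENNReal.ofReal_ne_top
  calc _ ≤ ENNReal.ofReal (t ^ p) *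
        ∫⁻ x, ENNReal.ofReal (2 / q) ^ (p / q) * (M x ^ p * ENNReal.ofReal (υ x)) := by
        gcongr ENNReal.ofReal (t ^ p) * ?_
        refine lintegral_mono_ae ?_
        filter_upwards [enorm_diff_le hk hf.1 hg] with x hx
        rw [← mul_assoc]
        gcongr
        have hm : MeasurableSet {s : ℝ | ENNReal.ofReal |s| ≤ M x} :=
          measurableSet_le (by fun_prop) measurable_const
        have hin : ∫⁻ s, (levelSet t (q / q) k f).indicator
            (fun z => ENNReal.ofReal (|z.2| ^ (q - 1))) (x, s) ≤
            ENNReal.ofReal (2 / q) * M x ^ q := by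
          refine le_trans ?_ (lintegral_abs_rpow_le hq (M x))
          rw [← lintegral_indicator hm]
          refine lintegral_mono_ae ?_
          filter_upwards [hx] with s hs
          rw [div_self hq.ne']
          by_cases hmem : (x, s) ∈ levelSet t 1 k f
          · have hball := mem_heavyBalls_of_mem_levelSet hk ht hs hmem
            have h1 := le_maxRadius hball (Metric.mem_ball_self hball.1)
            have h2 : s ∈ {s : ℝ | ENNReal.ofReal |s| ≤ M x} := by
              refine le_trans (ENNReal.ofReal_le_ofReal ?_) h1
              have : (1 : ℝ) ≤ k := by exact_mod_cast hk
              nlinarith [abs_nonneg s]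
            rw [indicator_of_mem hmem, indicator_of_mem h2]
          · rw [indicator_of_notMem hmem]
            exact zero_le
        calc _ ≤ (ENNReal.ofReal (2 / q) * M x ^ q) ^ (p / q) := by gcongr
          _ = _ := by
            rw [ENNReal.mul_rpow_of_nonneg _ _ (by positivity), ← ENNReal.rpow_mul,
              mul_div_cancel₀ _ hq.ne']
    _ = ENNReal.ofReal (2 / q) ^ (p / q) * ENNReal.ofReal (((k : ℝ) ^ 2) ^ p) *
          (ENNReal.ofReal ((t / (k : ℝ) ^ 2) ^ p) * ∫⁻ x, M x ^ p * ENNReal.ofReal (υ x)) := by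
        rw [lintegral_const_mul' _ _ hc1]
        have : ENNReal.ofReal (t ^ p) = ENNReal.ofReal (((k : ℝ) ^ 2) ^ p) *
            ENNReal.ofReal ((t / (k : ℝ) ^ 2) ^ p) := by
          rw [← ENNReal.ofReal_mul (by positivity), ← Real.mul_rpow (by positivity) (by positivity)]
          congr 2
          field_simp
        rw [this]
        ring
    _ ≤ ENNReal.ofReal (2 / q) ^ (p / q) * ENNReal.ofReal (((k : ℝ) ^ 2) ^ p) *
          (apConst p υ * 50 ^ p * weightedEnergy p υ g) := by gcongr
    _ = ENNReal.ofReal (2 / q) ^ (p / q) * ENNReal.ofReal (((k : ℝ) ^ 2) ^ p) *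
          (apConst p υ * 50 ^ p) * weightedEnergy p υ g := by ring
    _ ≤ _ := by gcongr

/-! ### The dyadic functional for Muckenhoupt weights -/

/-- The interval of index `(j, m)` in the grid `𝒟^α`. -/
def dyadicInterval (α : ℝ) (i : ℤ × ℤ) : Set ℝ :=
  Ico ((2 : ℝ) ^ i.1 * (i.2 + (-1 : ℝ) ^ i.1 * α)) ((2 : ℝ) ^ i.1 * (i.2 + 1 + (-1 : ℝ) ^ i.1 * α))

theorem volume_dyadicInterval (α : ℝ) (i : ℤ × ℤ) :
    volume (dyadicInterval α i) = ENNReal.ofReal ((2 : ℝ) ^ i.1) := by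
  rw [dyadicInterval, Real.volume_Ico]
  congr 1
  ring

theorem dyadicInterval_index_unique {α x : ℝ} {j m n : ℤ} (hm : x ∈ dyadicInterval α (j, m))
    (hn : x ∈ dyadicInterval α (j, n)) : m = n := by
  have h2 : (0 : ℝ) < 2 ^ j := by positivity
  obtain ⟨h1, h3⟩ := hm
  obtain ⟨h4, h5⟩ := hn
  dsimp only at h1 h3 h4 h5
  have a1 : (m : ℝ) < n + 1 := by
    have := lt_of_mul_lt_mul_left (h1.trans_lt h5) h2.le
    linarith
  have a2 : (n : ℝ) < m + 1 := by
    have := lt_of_mul_lt_mul_left (h4.trans_lt h3) h2.le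
    linarith
  have b1 : m < n + 1 := by exact_mod_cast a1
  have b2 : n < m + 1 := by exact_mod_cast a2
  omega

-- A geometric sum dominated by its largest term; p ≥ 1 gives 2^(-ip) ≤ 2^(-i), so the constant 2
-- serves for all p.
open Classical in
theorem tsum_zpow_le {p : ℝ} (hp : 1 ≤ p) (M : ℝ≥0∞) :
    ∑' j : ℤ, (if ENNReal.ofReal ((2 : ℝ) ^ j) ≤ M then ENNReal.ofReal ((2 : ℝ) ^ j) ^ p else 0) ≤
      2 * M ^ p := by
  have hp0 : 0 < p := by linarith
  rcases eq_or_ne M ∞ with rfl | hM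
  · rw [ENNReal.top_rpow_of_pos hp0, ENNReal.mul_top (by norm_num)]
    exact le_top
  rcases eq_or_ne M 0 with rfl | hM0
  · rw [ENNReal.tsum_eq_zero.2]
    · exact zero_le
    · intro j
      rw [if_neg]
      simp only [nonpos_iff_eq_zero, ENNReal.ofReal_eq_zero, not_le]
      positivity
  have hm : 0 < M.toReal := ENNReal.toReal_pos hM0 hM
  obtain ⟨J, hJ1, hJ2⟩ := exists_mem_Ico_zpow hm one_lt_two
  have hle : ∀ j : ℤ, ENNReal.ofReal ((2 : ℝ) ^ j) ≤ M → j ≤ J := by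
    intro j hj
    rw [ENNReal.ofReal_le_iff_le_toReal hM] at hj
    have := (zpow_lt_zpow_iff_right₀ (one_lt_two : (1 : ℝ) < 2)).1 (hj.trans_lt hJ2)
    omega
  have hinj : Function.Injective fun i : ℕ => J - (i : ℤ) := fun a b hab => by
    dsimp only at hab; omega
  rw [← hinj.tsum_eq]
  · calc _ ≤ ∑' i : ℕ, ENNReal.ofReal ((2 : ℝ) ^ J) ^ p * 2⁻¹ ^ i := by
          refine ENNReal.tsum_le_tsum fun i => ?_
          split_ifs
          · have e : ENNReal.ofReal ((2 : ℝ) ^ (J - (i : ℤ))) =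
                ENNReal.ofReal ((2 : ℝ) ^ J) * 2⁻¹ ^ i := by
              rw [zpow_sub₀ two_ne_zero, zpow_natCast, div_eq_mul_inv,
                ENNReal.ofReal_mul (by positivity), ← inv_pow, ENNReal.ofReal_pow (by norm_num),
                ENNReal.ofReal_inv_of_pos two_pos, ENNReal.ofReal_ofNat]
            rw [e, ENNReal.mul_rpow_of_nonneg _ _ hp0.le]
            gcongr
            have h1 : ((2 : ℝ≥0∞)⁻¹) ^ i ≤ 1 := pow_le_one₀ zero_le (by norm_num)
            calc _ ≤ (((2 : ℝ≥0∞)⁻¹) ^ i) ^ (1 : ℝ) := ENNReal.rpow_le_rpow_of_exponent_ge h1 hp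
              _ = _ := ENNReal.rpow_one _
          · exact zero_le
      _ = 2 * ENNReal.ofReal ((2 : ℝ) ^ J) ^ p := by
          rw [ENNReal.tsum_mul_left, ENNReal.tsum_geometric, ENNReal.one_sub_inv_two, inv_inv,
            mul_comm]
      _ ≤ _ := by
          gcongr
          exact (ENNReal.ofReal_le_iff_le_toReal hM).2 hJ1
  · intro j hj
    rw [Function.mem_support, ne_eq, ite_eq_right_iff, Classical.not_imp] at hj
    have := hle j hj.1
    exact ⟨(J - j).toNat, by dsimp only; omega⟩

/-- By the Poincaré inequality, a level interval for β = 2 satisfies ∫_Q |g| > t |Q|². The ball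
about its midpoint with the full length |Q| as radius contains Q and is heavy at the same level t.
-/
theorem mem_heavyBalls_of_dyadicLevel {k : ℕ} (hk : 1 ≤ k) {f g : ℝ → ℝ} {α t : ℝ} (i : ℤ × ℤ)
    (hf : LocallyIntegrable f volume) (hg : IsWeakDeriv k f g)
    (h : dyadicInterval α i ∈ dyadicLevel α t 2 k f) :
    ((2 : ℝ) ^ i.1 * (i.2 + 1 / 2 + (-1 : ℝ) ^ i.1 * α), (2 : ℝ) ^ i.1) ∈ heavyBalls t g := by
  have h2 : (0 : ℝ) < 2 ^ i.1 := by positivity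
  refine ⟨h2, ?_⟩
  have h1 := h.2
  rw [volume_dyadicInterval] at h1
  set s : ℝ := 2 ^ i.1
  set a := s * (i.2 + (-1 : ℝ) ^ i.1 * α)
  set b := s * (i.2 + 1 + (-1 : ℝ) ^ i.1 * α)
  have hab : b - a = s := by simp only [a, b]; ring
  have hP := localApprox_le hk hf hg (a := a) (b := b) (by linarith)
  have hlt := h1.trans_le hP
  rw [hab] at hlt
  have hs0 : ENNReal.ofReal s ≠ 0 := by simp [h2]
  have e : ENNReal.ofReal t * ENNReal.ofReal s ^ (2 + (k : ℝ)) =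
      ENNReal.ofReal s ^ k * (ENNReal.ofReal t * ENNReal.ofReal s ^ 2) := by
    rw [show (2 + (k : ℝ)) = ((k + 2 : ℕ) : ℝ) by push_cast; ring, ENNReal.rpow_natCast, pow_add]
    ring
  rw [e] at hlt
  dsimp only
  have hlt2 := lt_of_mul_lt_mul_left' hlt
  rw [ENNReal.ofReal_mul' (by positivity), ENNReal.ofReal_pow h2.le]
  refine hlt2.trans_le (lintegral_mono_set ?_)
  rw [Real.closedBall_eq_Icc]
  refine Icc_subset_Icc ?_ ?_
  · simp only [a]; linarith
  · simp only [b]; linarith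

/-- The sum equals the integral against υ of the sum of |Q|^p over level intervals Q containing x.
Each generation has at most one such Q, and |Q| ≤ M(x), so the integrand is at most 2 M^p. -/
theorem IsAp.dyadicFunctional_le {k : ℕ} (hk : 1 ≤ k) {p : ℝ} (hp : 1 ≤ p)
    {υ : ℝ → ℝ} (h : IsAp p υ) : ∃ C : ℝ, 0 < C ∧
      ∀ α : ℝ, ∀ f g : ℝ → ℝ, MemHomSobolev k p υ f → IsWeakDeriv k f g →
        dyadicFunctional k p 2 α υ f ≤ ENNReal.ofReal C * weightedEnergy p υ g := by
  classical
  have hp0 : 0 < p := by linarith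
  have hA : 2 * (apConst p υ * 50 ^ p) ≠ ∞ :=
    ENNReal.mul_ne_top (by norm_num)
      (ENNReal.mul_ne_top h.2.2.ne (ENNReal.rpow_ne_top_of_nonneg hp0.le (by norm_num)))
  obtain ⟨C, hC, hAC⟩ := exists_ofReal_ge hA
  refine ⟨C, hC, fun α f g hf hg => iSup₂_le fun t ht => ?_⟩
  have hυm : AEMeasurable υ volume := h.2.1.aestronglyMeasurable.aemeasurable
  set M := maxRadius (heavyBalls t g)
  have hmain := (h.avgBound hp).maxRadius_heavyBalls hp hυm hg.1.aestronglyMeasurable.aemeasurable ht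
  set w : ℝ → ℝ≥0∞ := fun x => ENNReal.ofReal (υ x)
  have hwm : AEMeasurable w volume := hυm.ennreal_ofReal
  set L := dyadicLevel α t 2 k f
  have hidx : ∀ Q : L, ∃ i : ℤ × ℤ, (Q : Set ℝ) = dyadicInterval α i := fun Q => by
    obtain ⟨j, m, hjm⟩ := Q.2.1
    exact ⟨(j, m), hjm⟩
  choose e he using hidx
  have heinj : Function.Injective e := fun Q R hQR => by
    apply Subtype.ext
    rw [he Q, he R, hQR]
  set T : ℤ × ℤ → ℝ → ℝ≥0∞ := fun i => if dyadicInterval α i ∈ L then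
    (dyadicInterval α i).indicator fun _ => ENNReal.ofReal ((2 : ℝ) ^ i.1) ^ p else 0
  have hmeas : ∀ i, MeasurableSet (dyadicInterval α i) := fun i => measurableSet_Ico
  have hT : ∀ i, Measurable (T i) := fun i => by
    simp only [T]
    split_ifs
    · exact measurable_const.indicator (hmeas i)
    · exact measurable_const
  have hTz : ∀ i x, x ∉ dyadicInterval α i → T i x = 0 := fun i x hx => by
    simp only [T]
    split_ifs
    · exact indicator_of_notMem hx _
    · rfl
  have hterm : ∀ Q : L, volume (Q : Set ℝ) ^ (p * (2 - 1)) * ∫⁻ x in (Q : Set ℝ), w x =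
      ∫⁻ x, T (e Q) x * w x := by
    intro Q
    have hQ : dyadicInterval α (e Q) ∈ L := he Q ▸ Q.2
    rw [he Q, volume_dyadicInterval, show p * (2 - 1) = p by ring,
      ← lintegral_const_mul' _ _ (ENNReal.rpow_ne_top_of_nonneg hp0.le ENNReal.ofReal_ne_top),
      ← lintegral_indicator (hmeas _)]
    refine lintegral_congr fun x => ?_
    simp only [T, if_pos hQ]
    by_cases hx : x ∈ dyadicInterval α (e Q)
    · rw [indicator_of_mem hx, indicator_of_mem hx]
    · rw [indicator_of_notMem hx, indicator_of_notMem hx, zero_mul]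
  have hpt : ∀ x, ∑' i, T i x ≤ 2 * M x ^ p := by
    intro x
    refine le_trans ?_ (tsum_zpow_le hp (M x))
    rw [ENNReal.tsum_prod' (f := fun i => T i x)]
    refine ENNReal.tsum_le_tsum fun j => ?_
    by_cases hex : ∃ m, T (j, m) x ≠ 0
    · obtain ⟨m, hm⟩ := hex
      have hL : dyadicInterval α (j, m) ∈ L := by
        by_contra hn
        simp [T, hn] at hm
      have hxm : x ∈ dyadicInterval α (j, m) := by
        by_contra hn
        exact hm (hTz _ _ hn)
      rw [tsum_eq_single m]
      · have hb := mem_heavyBalls_of_dyadicLevel hk (j, m) hf.1 hg hL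
        have h2 : (0 : ℝ) < 2 ^ j := by positivity
        have hle := le_maxRadius hb (x := x) (by
          rw [Real.ball_eq_Ioo]
          obtain ⟨h3, h4⟩ := hxm
          dsimp only at h3 h4 ⊢
          constructor <;> linarith)
        rw [if_pos hle]
        simp only [T, if_pos hL, indicator_of_mem hxm]
        exact le_rfl
      · intro n hn
        by_contra hne
        refine hn (dyadicInterval_index_unique ?_ hxm)
        by_contra hx
        exact hne (hTz _ _ hx)
    · rw [not_exists] at hex
      rw [ENNReal.tsum_eq_zero.2 fun m => not_not.1 (hex m)]
      exact zero_le
  calc _ = ENNReal.ofReal (t ^ p) * ∑' Q : L, ∫⁻ x, T (e Q) x * w x := by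
        congr 1
        exact tsum_congr hterm
    _ ≤ ENNReal.ofReal (t ^ p) * ∑' i, ∫⁻ x, T i x * w x := by
        gcongr
        exact ENNReal.tsum_comp_le_tsum_of_injective heinj fun i => ∫⁻ x, T i x * w x
    _ = ENNReal.ofReal (t ^ p) * ∫⁻ x, (∑' i, T i x) * w x := by
        rw [← lintegral_tsum (f := fun i x => T i x * w x) fun i => (hT i).aemeasurable.mul hwm]
        simp_rw [ENNReal.tsum_mul_right]
    _ ≤ ENNReal.ofReal (t ^ p) * ∫⁻ x, 2 * (M x ^ p * w x) := by
        gcongr ENNReal.ofReal (t ^ p) * ∫⁻ x, ?_ with x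
        rw [← mul_assoc]
        gcongr
        exact hpt x
    _ = 2 * (ENNReal.ofReal (t ^ p) * ∫⁻ x, M x ^ p * w x) := by
        rw [lintegral_const_mul' _ _ (by norm_num)]
        ring
    _ ≤ 2 * (apConst p υ * 50 ^ p * weightedEnergy p υ g) := by gcongr
    _ = 2 * (apConst p υ * 50 ^ p) * weightedEnergy p υ g := by ring
    _ ≤ _ := by gcongr

/-! ### Necessity of the Muckenhoupt condition -/

theorem integrable_of_bounded_of_support {g : ℝ → ℝ} (hg : AEMeasurable g volume) (h0 : ∀ x, 0 ≤ g x)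
    {N : ℝ} (hN : ∀ x, g x ≤ N) {a b : ℝ} (hs : ∀ x, x ∉ Icc a b → g x = 0) :
    Integrable g volume := by
  have h1 : IntegrableOn g (Icc a b) volume :=
    Measure.integrableOn_of_bounded (M := N) (by simp) hg.aestronglyMeasurable
      (Filter.Eventually.of_forall fun x => by
        rw [Real.norm_eq_abs, abs_of_nonneg (h0 x)]; exact hN x)
  refine (integrableOn_iff_integrable_of_support_subset fun x hx => ?_).1 h1
  by_contra hn
  exact hx (hs x hn)

theorem weightedEnergy_lt_top {p : ℝ} (hp : 0 < p) {υ : ℝ → ℝ} (hl : LocallyIntegrable υ volume)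
    {g : ℝ → ℝ} (h0 : ∀ x, 0 ≤ g x)
    {N : ℝ} (hN : ∀ x, g x ≤ N) {a b : ℝ} (hs : ∀ x, x ∉ Icc a b → g x = 0) :
    weightedEnergy p υ g < ∞ := by
  have hW : ∫⁻ x in Icc a b, ENNReal.ofReal (υ x) < ∞ :=
    (hl.integrableOn_isCompact (isCompact_Icc (a := a) (b := b))).lintegral_lt_top
  refine lt_of_le_of_lt (b := ENNReal.ofReal N ^ p * ∫⁻ x in Icc a b, ENNReal.ofReal (υ x)) ?_
    (ENNReal.mul_lt_top (ENNReal.rpow_lt_top_of_nonneg hp.le ENNReal.ofReal_ne_top) hW)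
  rw [weightedEnergy, ← lintegral_const_mul' _ _
    (ENNReal.rpow_ne_top_of_nonneg hp.le ENNReal.ofReal_ne_top),
    ← lintegral_indicator measurableSet_Icc]
  refine lintegral_mono fun x => ?_
  by_cases hx : x ∈ Icc a b
  · rw [indicator_of_mem hx, Real.enorm_of_nonneg (h0 x)]
    gcongr
    exact hN x
  · rw [hs x hx, enorm_zero, ENNReal.zero_rpow_of_pos hp, zero_mul]
    exact zero_le

theorem weightedEnergy_indicator_one {p : ℝ} (hp : 0 < p) {υ : ℝ → ℝ} {J : Set ℝ}
    (hJ : MeasurableSet J) :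
    weightedEnergy p υ (J.indicator fun _ => 1) = ∫⁻ x in J, ENNReal.ofReal (υ x) := by
  rw [weightedEnergy, ← lintegral_indicator hJ]
  refine lintegral_congr fun x => ?_
  by_cases hx : x ∈ J
  · simp [hx]
  · simp [hx, hp]

theorem lintegral_enorm_eq_ofReal_integral {g : ℝ → ℝ} (hg : Integrable g volume)
    (h0 : ∀ x, 0 ≤ g x) : ∫⁻ x, ‖g x‖ₑ = ENNReal.ofReal (∫ x, g x) := by
  rw [← ofReal_integral_norm_eq_lintegral_enorm hg]
  congr 1
  exact integral_congr_ae (Filter.Eventually.of_forall fun x => by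
    simp [abs_of_nonneg (h0 x)])

theorem prim_memHomSobolev {p : ℝ} (hp : 0 < p) {υ : ℝ → ℝ} (hl : LocallyIntegrable υ volume)
    {g : ℝ → ℝ} (hg : AEMeasurable g volume) (h0 : ∀ x, 0 ≤ g x)
    {N : ℝ} (hN : ∀ x, g x ≤ N) {a b : ℝ} (hs : ∀ x, x ∉ Icc a b → g x = 0) (k : ℕ) :
    MemHomSobolev k p υ (prim a k g) := by
  have hgl := (integrable_of_bounded_of_support hg h0 hN hs).locallyIntegrable
  exact ⟨prim_locallyIntegrable hgl a k, g, prim_isWeakDeriv hgl a k,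
    weightedEnergy_lt_top hp hl h0 hN hs⟩

/-- The one-third trick: every bounded interval lies well inside an interval of comparable length
of one of the grids `𝒟^α`. -/
theorem exists_dyadicInterval_around {a b : ℝ} (hab : a < b) : ∃ α ∈ ({0, 1 / 3, 2 / 3} : Set ℝ),
    ∃ i : ℤ × ℤ, ∃ A : ℝ, dyadicInterval α i = Ico A (A + (2 : ℝ) ^ i.1) ∧
      A + (2 : ℝ) ^ i.1 / 8 ≤ a ∧ b ≤ A + (2 : ℝ) ^ i.1 - (2 : ℝ) ^ i.1 / 8 ∧
      (2 : ℝ) ^ i.1 ≤ 24 * (b - a) := by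
  -- This makes s = 2^(n+1) larger than 12(b - a), so [a,b] enlarged by s/8 on both sides has length
  -- less than s(1/12 + 1/4) = s/3.
  obtain ⟨n, hn1, hn2⟩ := exists_mem_Ico_zpow (show 0 < 12 * (b - a) by linarith)
    (one_lt_two : (1 : ℝ) < 2)
  set j := n + 1
  have hj : (2 : ℝ) ^ j = 2 ^ n * 2 := zpow_add_one₀ two_ne_zero n
  set s : ℝ := 2 ^ j
  have hs : 0 < s := by positivity
  have hs24 : s ≤ 24 * (b - a) := by rw [hj]; linarith
  set u := (a - s / 8) / s
  set v := (b + s / 8) / s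
  have hu : s * u = a - s / 8 := mul_div_cancel₀ _ hs.ne'
  have hv : s * v = b + s / 8 := mul_div_cancel₀ _ hs.ne'
  have huv : v - u < 1 / 3 := by
    have : s * (v - u) < s * (1 / 3) := by rw [mul_sub, hu, hv]; linarith
    exact lt_of_mul_lt_mul_left this hs.le
  have key : ∀ α ∈ ({0, 1 / 3, 2 / 3} : Set ℝ), v < ⌊u - (-1 : ℝ) ^ j * α⌋ + 1 + (-1 : ℝ) ^ j * α →
      ∃ α ∈ ({0, 1 / 3, 2 / 3} : Set ℝ),
    ∃ i : ℤ × ℤ, ∃ A : ℝ, dyadicInterval α i = Ico A (A + (2 : ℝ) ^ i.1) ∧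
      A + (2 : ℝ) ^ i.1 / 8 ≤ a ∧ b ≤ A + (2 : ℝ) ^ i.1 - (2 : ℝ) ^ i.1 / 8 ∧
      (2 : ℝ) ^ i.1 ≤ 24 * (b - a) := by
    intro α hα hlt
    refine ⟨α, hα, (j, ⌊u - (-1 : ℝ) ^ j * α⌋), s * (⌊u - (-1 : ℝ) ^ j * α⌋ + (-1 : ℝ) ^ j * α),
      ?_, ?_, ?_, hs24⟩
    · rw [dyadicInterval]
      congr 1
      simp only [s]
      ring
    · have := Int.floor_le (u - (-1 : ℝ) ^ j * α)
      have h1 : s * (⌊u - (-1 : ℝ) ^ j * α⌋ + (-1 : ℝ) ^ j * α) ≤ s * u := by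
        gcongr; linarith
      change _ + s / 8 ≤ a
      linarith
    · have h1 : s * v < s * (⌊u - (-1 : ℝ) ^ j * α⌋ + 1 + (-1 : ℝ) ^ j * α) := by gcongr
      change b ≤ _ + s - s / 8
      linarith
  by_cases h0 : v < ⌊u⌋ + 1
  · exact key 0 (by simp) (by simpa using h0)
  by_cases h1 : v < ⌊u - (-1 : ℝ) ^ j * (1 / 3)⌋ + 1 + (-1 : ℝ) ^ j * (1 / 3)
  · exact key (1 / 3) (by simp) h1
  -- If both grids failed, each would have an endpoint in (u,v], an interval shorter than 1/3. But
  -- endpoints of the two grids, at unit scale, lie in ℤ and ℤ ± 1/3, so they are at least 1/3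
  -- apart.
  exfalso
  rw [not_lt] at h0 h1
  have l0 := Int.lt_floor_add_one u
  have l1 := Int.lt_floor_add_one (u - (-1 : ℝ) ^ j * (1 / 3))
  set m := ⌊u⌋
  set m' := ⌊u - (-1 : ℝ) ^ j * (1 / 3)⌋
  rcases Int.even_or_odd j with he | ho
  · rw [he.neg_one_zpow] at h1 l1
    have a1 : (m : ℝ) < m' + 1 := by linarith
    have a2 : (m' : ℝ) < m := by linarith
    have b1 : m < m' + 1 := by exact_mod_cast a1
    have b2 : m' < m := by exact_mod_cast a2
    omega
  · rw [ho.neg_one_zpow] at h1 l1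
    have a1 : (m' : ℝ) < m + 1 := by linarith
    have a2 : (m : ℝ) < m' := by linarith
    have b1 : m' < m + 1 := by exact_mod_cast a1
    have b2 : m < m' := by exact_mod_cast a2
    omega

theorem ofReal_mul_le_of_le {κ C : ℝ} (hκ : 0 < κ) {X E : ℝ≥0∞}
    (h : ENNReal.ofReal κ * X ≤ ENNReal.ofReal C * E) : X ≤ ENNReal.ofReal (C / κ) * E := by
  have hκ0 : ENNReal.ofReal κ ≠ 0 := by simp [hκ]
  rw [← ENNReal.mul_le_mul_iff_right hκ0 ENNReal.ofReal_ne_top, ← mul_assoc,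
    ← ENNReal.ofReal_mul hκ.le, mul_div_cancel₀ _ hκ.ne']
  exact h

/-- A single interval Q of the sum suffices: it has length comparable to b - a and contains [a,b]
well inside, so the approximation error of the primitive of g is at least c |Q|^k ∫ g. -/
theorem testAvgBound_of_dyadic {k : ℕ} (hk : 1 ≤ k) {p : ℝ} (hp : 1 ≤ p) {υ : ℝ → ℝ}
    (hl : LocallyIntegrable υ volume) {β C : ℝ}
    (h : ∀ α ∈ ({0, 1 / 3, 2 / 3} : Set ℝ),
      ∀ f g : ℝ → ℝ, MemHomSobolev k p υ f → IsWeakDeriv k f g →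
        dyadicFunctional k p β α υ f ≤ ENNReal.ofReal C * weightedEnergy p υ g) :
    ∃ K : ℝ≥0∞, K ≠ ∞ ∧ TestAvgBound p υ K := by
  have hp0 : 0 < p := by linarith
  obtain ⟨c, hc, hlow⟩ := exists_le_localApprox k hk
  refine ⟨ENNReal.ofReal (C / ((c / 2) ^ p * (24 ^ p)⁻¹)), ENNReal.ofReal_ne_top,
    fun a b hab g hg h0 ⟨N, hN⟩ hs => ?_⟩
  have hgi := integrable_of_bounded_of_support hg h0 hN hs
  rw [lintegral_enorm_eq_ofReal_integral hgi h0]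
  set G := ∫ x, g x
  have hG_nonneg : 0 ≤ G := integral_nonneg h0
  rcases hG_nonneg.eq_or_lt with hG0 | hG0
  · rw [← hG0, ENNReal.ofReal_zero, ENNReal.zero_rpow_of_pos hp0, zero_mul]
    exact zero_le
  obtain ⟨α, hα, i, A, hQ, hA1, hA2, hs24⟩ := exists_dyadicInterval_around hab
  set s : ℝ := 2 ^ i.1
  have hs0 : 0 < s := by positivity
  have hWD := prim_isWeakDeriv hgi.locallyIntegrable a k
  have hmem := prim_memHomSobolev hp0 hl hg h0 hN hs k
  have hlb := hlow (prim a k g) g A (A + s) (by linarith) hmem.1 hWD h0 fun x hx => hs x fun hx' => hx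
    ⟨by linarith [hx'.1], by linarith [hx'.2]⟩
  rw [add_sub_cancel_left] at hlb
  -- Half of the lower bound, for a strict inequality. The factor s^(-β) makes t^p s^(p(β-1))
  -- proportional to s^(-p), whatever β is.
  set t : ℝ := c / 2 * G * s ^ (-β)
  have ht : 0 < t := by positivity
  have hvol : volume (Ico A (A + s)) = ENNReal.ofReal s := by
    rw [Real.volume_Ico, add_sub_cancel_left]
  have hlevel : Ico A (A + s) ∈ dyadicLevel α t β k (prim a k g) := by
    refine ⟨⟨i.1, i.2, by rw [← hQ]; rfl⟩, lt_of_lt_of_le ?_ hlb⟩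
    rw [hvol, ENNReal.ofReal_rpow_of_pos hs0, ← ENNReal.ofReal_mul ht.le]
    have e : t * s ^ (β + (k : ℝ)) = c / 2 * G * s ^ k := by
      simp only [t]
      rw [mul_assoc, ← Real.rpow_add hs0, neg_add_cancel_left, Real.rpow_natCast]
    rw [e]
    have : 0 < c * s ^ k * G := by positivity
    exact (ENNReal.ofReal_lt_ofReal_iff this).2 (by linarith)
  have hfun := h α hα (prim a k g) g hmem hWD
  have hterm : ENNReal.ofReal (t ^ p) * (volume (Ico A (A + s)) ^ (p * (β - 1)) *
      ∫⁻ x in Ico A (A + s), ENNReal.ofReal (υ x)) ≤ ENNReal.ofReal C * weightedEnergy p υ g := by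
    refine le_trans ?_ hfun
    refine le_iSup₂_of_le t ht ?_
    gcongr
    exact ENNReal.le_tsum (f := fun Q : dyadicLevel α t β k (prim a k g) =>
      volume (Q : Set ℝ) ^ (p * (β - 1)) * ∫⁻ x in (Q : Set ℝ), ENNReal.ofReal (υ x))
      ⟨_, hlevel⟩
  have hreal : ENNReal.ofReal (t ^ p) * volume (Ico A (A + s)) ^ (p * (β - 1)) =
      ENNReal.ofReal ((c / 2) ^ p * (s ^ p)⁻¹) * ENNReal.ofReal G ^ p := by
    rw [hvol, ENNReal.ofReal_rpow_of_pos hs0, ENNReal.ofReal_rpow_of_pos hG0,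
      ← ENNReal.ofReal_mul (by positivity), ← ENNReal.ofReal_mul (by positivity)]
    congr 1
    simp only [t]
    rw [Real.mul_rpow (by positivity) (by positivity), Real.mul_rpow (by positivity) hG0.le,
      ← Real.rpow_mul hs0.le, mul_assoc, ← Real.rpow_add hs0, ← Real.rpow_neg hs0.le,
      show -β * p + p * (β - 1) = -p by ring]
    ring
  rw [← mul_assoc, hreal] at hterm
  have hsub : Icc a b ⊆ Ico A (A + s) := fun x hx => ⟨by linarith [hx.1], by linarith [hx.2]⟩
  have hba : 0 < b - a := by linarith
  have hmul : (0 : ℝ) < (c / 2) ^ p * (24 ^ p)⁻¹ := by positivity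
  rw [mul_right_comm]
  have hbap : 0 < (b - a) ^ p := by positivity
  rw [ENNReal.ofReal_rpow_of_pos hba, mul_assoc, mul_comm (weightedEnergy p υ g), ← mul_assoc,
    ← ENNReal.ofReal_mul' (by positivity), show C / ((c / 2) ^ p * (24 ^ p)⁻¹) * (b - a) ^ p =
      C / ((c / 2) ^ p * ((24 * (b - a)) ^ p)⁻¹) by
        rw [Real.mul_rpow (by norm_num) hba.le]; field_simp]
  refine ofReal_mul_le_of_le (by positivity) (le_trans ?_ hterm)
  rw [← mul_assoc]
  gcongr

/-- The exponents that occur may have either sign; compactness bounds the powers of |h|/ℓ when 3ℓ ≤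
|h| ≤ 4ℓ. -/
theorem rpow_bounds (e : ℝ) : ∃ m M : ℝ, 0 < m ∧ 0 < M ∧ ∀ u ∈ Icc (3 : ℝ) 4, m ≤ u ^ e ∧ u ^ e ≤ M := by
  have hc : ContinuousOn (fun u : ℝ => u ^ e) (Icc 3 4) := fun u hu =>
    (Real.continuousAt_rpow_const u e (Or.inl (show 0 < u by linarith [hu.1]).ne')).continuousWithinAt
  have hne : (Icc (3 : ℝ) 4).Nonempty := nonempty_Icc.2 (by norm_num)
  obtain ⟨x, hx, hmin⟩ := isCompact_Icc.exists_isMinOn hne hc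
  obtain ⟨y, hy, hmax⟩ := isCompact_Icc.exists_isMaxOn hne hc
  exact ⟨x ^ e, y ^ e, Real.rpow_pos_of_pos (by linarith [hx.1]) _,
    Real.rpow_pos_of_pos (by linarith [hy.1]) _, fun u hu => ⟨hmin hu, hmax hu⟩⟩

/-- The weighted estimate for an interval and its translates. -/
theorem translate_bound_of_bsvy {k : ℕ} (hk : 1 ≤ k) {p : ℝ} (hp : 1 ≤ p) {q : ℝ} (hq : 0 < q)
    {υ : ℝ → ℝ} (hl : LocallyIntegrable υ volume) {γ C : ℝ}
    (h : ∀ f g : ℝ → ℝ, MemHomSobolev k p υ f → IsWeakDeriv k f g →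
        bsvyFunctional k p q γ υ f ≤ ENNReal.ofReal C * weightedEnergy p υ g) :
    ∃ K : ℝ≥0∞, K ≠ ∞ ∧ ∀ a b : ℝ, a < b → ∀ g : ℝ → ℝ, AEMeasurable g volume → (∀ x, 0 ≤ g x) →
      (∃ N, ∀ x, g x ≤ N) → (∀ x, x ∉ Icc a b → g x = 0) → ∀ d ∈ ({-2, 2} : Set ℝ),
      (∫⁻ x, ‖g x‖ₑ) ^ p *
        ∫⁻ x in Icc (a + d * (b - a)) (b + d * (b - a)), ENNReal.ofReal (υ x) ≤
      K * ENNReal.ofReal (b - a) ^ p * weightedEnergy p υ g := by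
  have hp0 : 0 < p := by linarith
  have hk0 : (0 : ℝ) < k := by exact_mod_cast hk
  set e : ℝ := k + γ / q
  obtain ⟨_, M, _, hM, hMb⟩ := rpow_bounds e
  obtain ⟨m, _, hm, _, hmb⟩ := rpow_bounds (γ - 1)
  set D : ℝ := ((k : ℝ) ^ (k - 1))⁻¹ / (2 * M)
  have hD : 0 < D := by positivity
  refine ⟨ENNReal.ofReal (C / (D ^ p * m ^ (p / q))), ENNReal.ofReal_ne_top,
    fun a b hab g hg h0 ⟨N, hN⟩ hs d hd => ?_⟩
  have hgi := integrable_of_bounded_of_support hg h0 hN hs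
  have hGI : ∫ x in Icc a b, g x = ∫ x, g x :=
    setIntegral_eq_integral_of_forall_compl_eq_zero fun x hx => hs x hx
  rw [lintegral_enorm_eq_ofReal_integral hgi h0]
  set G := ∫ x, g x
  have hG_nonneg : 0 ≤ G := integral_nonneg h0
  rcases hG_nonneg.eq_or_lt with hG0 | hG0
  · rw [← hG0, ENNReal.ofReal_zero, ENNReal.zero_rpow_of_pos hp0, zero_mul]
    exact zero_le
  have hmem := prim_memHomSobolev hp0 hl hg h0 hN hs k
  have hWD := prim_isWeakDeriv hgi.locallyIntegrable a k
  set ℓ := b - a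
  have hℓ : 0 < ℓ := by simp only [ℓ]; linarith
  set J := Icc (a + d * ℓ) (b + d * ℓ)
  set f := prim a k g
  -- Steps of length 3ℓ to 4ℓ towards the support carry the difference across all of [a,b] from any
  -- point of the translate.
  have hdiff : ∃ S : Set ℝ, MeasurableSet S ∧ volume S = ENNReal.ofReal ℓ ∧
      (∀ s ∈ S, |s| ∈ Icc (3 * ℓ) (4 * ℓ)) ∧
      ∀ x ∈ J, ∀ s ∈ S, (ℓ / k) ^ (k - 1) * G ≤ |diff k s f x| := by
    obtain ⟨n, hn⟩ := Nat.exists_eq_add_of_le' hk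
    have hw : (n : ℝ) * (ℓ / k) ≤ ℓ := by
      rw [mul_div_assoc', div_le_iff₀ hk0, mul_comm]
      gcongr
      rw [hn]; linarith
    have hw0 : 0 < ℓ / k := by positivity
    have hw1 : ℓ / k ≤ ℓ := div_le_self hℓ.le (by exact_mod_cast hk)
    rcases hd with rfl | rfl
    · refine ⟨Icc (3 * ℓ) (4 * ℓ), measurableSet_Icc, ?_, ?_, ?_⟩
      · rw [Real.volume_Icc]; congr 1; ring
      · intro s hs'
        rwa [abs_of_pos (by linarith [hs'.1])]
      · intro x hx s hs'
        have hx1 := hx.1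
        have hx2 := hx.2
        have := diff_prim_ge hgi.locallyIntegrable h0 a n (h := s) (x := x) (σ := 0) (w := ℓ / k)
          (u := a) (v := b) le_rfl hw0.le (by linarith [hs'.1])
          (by rw [zero_add]; simp only [ℓ] at *; linarith)
          (by rw [mul_zero, add_zero]; have := hs'.1; simp only [ℓ] at *; linarith)
        rw [hGI, ← hn] at this
        rw [show k - 1 = n by omega]
        exact this.trans (le_abs_self _)
    · refine ⟨Icc (-(4 * ℓ)) (-(3 * ℓ)), measurableSet_Icc, ?_, ?_, ?_⟩
      · rw [Real.volume_Icc]; congr 1; ring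
      · intro s hs'
        rw [abs_of_neg (by linarith [hs'.2])]
        exact ⟨by linarith [hs'.2], by linarith [hs'.1]⟩
      · intro x hx s hs'
        have hx1 := hx.1
        have hx2 := hx.2
        have hs2 := hs'.2
        have hkn : (k : ℝ) = n + 1 := by rw [hn]; push_cast; rfl
        -- The step is reversed, starting at x - k|s|, and the confined variables sit at the top end
        -- [|s| - ℓ/k, |s|]. The swept interval then runs from x - |s| ≤ a to x - nℓ/k ≥ b.
        have := diff_prim_ge hgi.locallyIntegrable h0 a n (h := -s) (x := x - k * (-s))
          (σ := -s - ℓ / k) (w := ℓ / k) (u := a) (v := b) (by linarith) hw0.le (by linarith)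
          (by
            have e1 : x - k * -s + n * (-s - ℓ / k + ℓ / k) = x + s := by
              rw [hkn]; ring
            rw [e1]; simp only [ℓ] at *; linarith)
          (by
            have e1 : x - k * -s + n * (-s - ℓ / k) + -s = x - n * (ℓ / k) := by
              rw [hkn]; ring
            rw [e1]; simp only [ℓ] at *; linarith)
        rw [hGI, ← hn] at this
        rw [show k - 1 = n by omega, ← neg_neg s, abs_diff_neg]
        exact this.trans (le_abs_self _)
  obtain ⟨S, hSm, hSv, hSb, hSd⟩ := hdiff
  -- Chosen so that t |s|^(k+γ/q) is at most half the lower bound for the difference. In t^p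
  -- (ℓ^γ)^(p/q) the powers involving γ cancel, leaving a multiple of (G/ℓ)^p.
  set t : ℝ := D * (G / ℓ) * (ℓ ^ (γ / q))⁻¹
  have ht : 0 < t := by positivity
  have hu : ∀ s ∈ S, |s| / ℓ ∈ Icc (3 : ℝ) 4 := fun s hs' => by
    have := hSb s hs'
    exact ⟨by rw [le_div_iff₀ hℓ]; exact this.1, by rw [div_le_iff₀ hℓ]; exact this.2⟩
  have hpow : ∀ s ∈ S, ∀ r : ℝ, |s| ^ r = ℓ ^ r * (|s| / ℓ) ^ r := fun s hs' r => by
    rw [← Real.mul_rpow hℓ.le (by positivity), mul_div_cancel₀ _ hℓ.ne']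
  have hlev : ∀ x ∈ J, ∀ s ∈ S, (x, s) ∈ levelSet t (γ / q) k f := by
    intro x hx s hs'
    refine ⟨?_, ?_⟩
    · intro hz
      dsimp only at hz
      have := (hSb s hs').1
      rw [hz, abs_zero] at this
      linarith
    · dsimp only
      refine lt_of_lt_of_le ?_ (hSd x hx s hs')
      change t * |s| ^ e < _
      have h1 : 0 < (ℓ / k) ^ (k - 1) * G := by positivity
      have hℓe : ℓ ^ e = ℓ * ℓ ^ (k - 1) * ℓ ^ (γ / q) := by
        rw [← pow_succ', Nat.sub_add_cancel hk, ← Real.rpow_natCast, ← Real.rpow_add hℓ]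
      have hℓγ : 0 < ℓ ^ (γ / q) := by positivity
      calc t * |s| ^ e = t * (ℓ ^ e * (|s| / ℓ) ^ e) := by rw [hpow s hs']
        _ ≤ t * (ℓ ^ e * M) := by gcongr; exact (hMb _ (hu s hs')).2
        _ = (ℓ / k) ^ (k - 1) * G / 2 := by
          rw [hℓe]
          simp only [t, D]
          rw [div_pow]
          field_simp
        _ < _ := by linarith
  have hinner : ∀ x ∈ J, ENNReal.ofReal (m * ℓ ^ γ) ≤
      ∫⁻ s, (levelSet t (γ / q) k f).indicator
          (fun z => ENNReal.ofReal (|z.2| ^ (γ - 1))) (x, s) := by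
    intro x hx
    calc ENNReal.ofReal (m * ℓ ^ γ) = ∫⁻ _ in S, ENNReal.ofReal (m * ℓ ^ (γ - 1)) := by
          rw [setLIntegral_const, hSv, ← ENNReal.ofReal_mul (by positivity), mul_assoc,
            Real.rpow_sub_one hℓ.ne', div_mul_cancel₀ _ hℓ.ne']
      _ ≤ ∫⁻ s in S, (levelSet t (γ / q) k f).indicator
          (fun z => ENNReal.ofReal (|z.2| ^ (γ - 1))) (x, s) := by
          refine setLIntegral_mono' hSm fun s hs' => ?_
          rw [indicator_of_mem (hlev x hx s hs')]
          refine ENNReal.ofReal_le_ofReal ?_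
          dsimp only
          rw [hpow s hs', mul_comm]
          gcongr
          exact (hmb _ (hu s hs')).1
      _ ≤ _ := setLIntegral_le_lintegral _ _
  have hfun := h f g hmem hWD
  have hterm : ENNReal.ofReal (t ^ p) * (ENNReal.ofReal (m * ℓ ^ γ) ^ (p / q) *
      ∫⁻ x in J, ENNReal.ofReal (υ x)) ≤ ENNReal.ofReal C * weightedEnergy p υ g := by
    refine le_trans ?_ hfun
    refine le_iSup₂_of_le t ht ?_
    gcongr ENNReal.ofReal (t ^ p) * ?_
    rw [← lintegral_const_mul' _ _
      (ENNReal.rpow_ne_top_of_nonneg (by positivity) ENNReal.ofReal_ne_top)]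
    refine le_trans (setLIntegral_mono' measurableSet_Icc fun x hx => ?_)
      (setLIntegral_le_lintegral J _)
    gcongr
    exact hinner x hx
  have hreal : ENNReal.ofReal (t ^ p) * ENNReal.ofReal (m * ℓ ^ γ) ^ (p / q) =
      ENNReal.ofReal (D ^ p * m ^ (p / q) * (ℓ ^ p)⁻¹) * ENNReal.ofReal G ^ p := by
    rw [ENNReal.ofReal_rpow_of_pos (by positivity), ENNReal.ofReal_rpow_of_pos hG0,
      ← ENNReal.ofReal_mul (by positivity), ← ENNReal.ofReal_mul (by positivity)]
    congr 1
    have e1 : (ℓ ^ (γ / q)) ^ p = ℓ ^ (γ * (p / q)) := by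
      rw [← Real.rpow_mul hℓ.le]; congr 1; ring
    have hpos : 0 < ℓ ^ (γ * (p / q)) := by positivity
    simp only [t]
    rw [Real.mul_rpow (by positivity) (by positivity), Real.mul_rpow hD.le (by positivity),
      Real.mul_rpow hm.le (by positivity), Real.inv_rpow (by positivity), e1,
      ← Real.rpow_mul hℓ.le, Real.div_rpow hG0.le hℓ.le]
    field_simp
  rw [← mul_assoc, hreal] at hterm
  rw [mul_right_comm, ENNReal.ofReal_rpow_of_pos hℓ, mul_assoc, mul_comm (weightedEnergy p υ g),
    ← mul_assoc, ← ENNReal.ofReal_mul' (by positivity),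
    show C / (D ^ p * m ^ (p / q)) * ℓ ^ p = C / (D ^ p * m ^ (p / q) * (ℓ ^ p)⁻¹) by field_simp]
  refine ofReal_mul_le_of_le (by positivity) ?_
  rwa [← mul_assoc]

/-- The translate bound is used twice: for g with d = -2, which puts the weight on I - 2ℓ, and for
the indicator of I - 2ℓ with d = 2, which gives υ(I) ≤ K υ(I - 2ℓ). Hence the constant K². -/
theorem testAvgBound_of_bsvy {k : ℕ} (hk : 1 ≤ k) {p : ℝ} (hp : 1 ≤ p) {q : ℝ} (hq : 0 < q)
    {υ : ℝ → ℝ} (hl : LocallyIntegrable υ volume) {γ C : ℝ}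
    (h : ∀ f g : ℝ → ℝ, MemHomSobolev k p υ f → IsWeakDeriv k f g →
        bsvyFunctional k p q γ υ f ≤ ENNReal.ofReal C * weightedEnergy p υ g) :
    ∃ K : ℝ≥0∞, K ≠ ∞ ∧ TestAvgBound p υ K := by
  have hp0 : 0 < p := by linarith
  obtain ⟨K, hK, hb⟩ := translate_bound_of_bsvy hk hp hq hl h
  refine ⟨K * K, ENNReal.mul_ne_top hK hK, fun a b hab g hg h0 hN hs => ?_⟩
  set ℓ := b - a
  have hℓ : 0 < ℓ := by simp only [ℓ]; linarith
  have hL0 : ENNReal.ofReal ℓ ^ p ≠ 0 := by simp [hℓ]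
  have hL : ENNReal.ofReal ℓ ^ p ≠ ∞ := ENNReal.rpow_ne_top_of_nonneg hp0.le ENNReal.ofReal_ne_top
  have hdoubling : ∫⁻ x in Icc a b, ENNReal.ofReal (υ x) ≤
      K * ∫⁻ x in Icc (a + -2 * ℓ) (b + -2 * ℓ), ENNReal.ofReal (υ x) := by
    set J := Icc (a + -2 * ℓ) (b + -2 * ℓ)
    have := hb (a + -2 * ℓ) (b + -2 * ℓ) (by linarith) (J.indicator fun _ => 1)
      (measurable_const.indicator measurableSet_Icc).aemeasurable
      (fun x => indicator_nonneg (fun _ _ => zero_le_one) x)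
      ⟨1, fun x => indicator_apply_le' (fun _ => le_rfl) fun _ => zero_le_one⟩
      (fun x hx => indicator_of_notMem hx _) 2 (by simp)
    have e1 : b + -2 * ℓ - (a + -2 * ℓ) = ℓ := by simp only [ℓ]; ring
    rw [e1, show a + -2 * ℓ + 2 * ℓ = a by ring, show b + -2 * ℓ + 2 * ℓ = b by ring] at this
    have i1 : ∫⁻ x, ‖J.indicator (fun _ => (1 : ℝ)) x‖ₑ = ENNReal.ofReal ℓ := by
      simp_rw [enorm_indicator_eq_indicator_enorm]
      rw [lintegral_indicator measurableSet_Icc]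
      simp [ℓ]
    have i2 := weightedEnergy_indicator_one hp0 (υ := υ) (measurableSet_Icc : MeasurableSet J)
    rw [i1, i2, mul_comm K, mul_assoc] at this
    exact (ENNReal.mul_le_mul_iff_right hL0 hL).1 this
  calc (∫⁻ x, ‖g x‖ₑ) ^ p * ∫⁻ x in Icc a b, ENNReal.ofReal (υ x)
      ≤ (∫⁻ x, ‖g x‖ₑ) ^ p * (K * ∫⁻ x in Icc (a + -2 * ℓ) (b + -2 * ℓ), ENNReal.ofReal (υ x)) := by
        gcongr
    _ = K * ((∫⁻ x, ‖g x‖ₑ) ^ p *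
          ∫⁻ x in Icc (a + -2 * ℓ) (b + -2 * ℓ), ENNReal.ofReal (υ x)) := by ring
    _ ≤ K * (K * ENNReal.ofReal ℓ ^ p * weightedEnergy p υ g) := by
        gcongr K * ?_
        exact hb a b hab g hg h0 hN hs (-2) (by simp)
    _ = _ := by ring

theorem TestAvgBound.mono {p : ℝ} {υ : ℝ → ℝ} {K K' : ℝ≥0∞} (h : TestAvgBound p υ K) (hK : K ≤ K') :
    TestAvgBound p υ K' := fun a b hab g hg h0 hN hs =>
  (h a b hab g hg h0 hN hs).trans (by gcongr)

theorem isAp_of_exists_testAvgBound {p : ℝ} (hp : 1 ≤ p) {υ : ℝ → ℝ} (h0 : ∀ x, 0 ≤ υ x)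
    (hl : LocallyIntegrable υ volume) (h : ∃ K : ℝ≥0∞, K ≠ ∞ ∧ TestAvgBound p υ K) : IsAp p υ := by
  obtain ⟨K, hK, hb⟩ := h
  -- The p = 1 argument divides by K, so K is replaced by the nonzero K + 1.
  exact (hb.mono (le_add_right le_rfl : K ≤ K + 1)).isAp hp h0 hl (by simp)
    (ENNReal.add_ne_top.2 ⟨hK, ENNReal.one_ne_top⟩)

end

end BSVY

/-! ### The equivalence -/

theorem corollary3p5 (υ : ℝ → ℝ) (hυ0 : ∀ x, 0 ≤ υ x)
    (hυ : MeasureTheory.LocallyIntegrable υ MeasureTheory.volume)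
    (k : ℕ) (hk : 1 ≤ k) (p : ℝ) (hp : 1 ≤ p) (q : ℝ) (hq : 0 < q)
    (hkq : 1 - 1 / q < (k : ℝ)) :
    List.TFAE
      [BSVY.IsAp p υ,
        ∃ γ ∈ BSVY.admissibleGamma p q, ∃ C : ℝ, 0 < C ∧
          ∀ f g : ℝ → ℝ, BSVY.MemHomSobolev k p υ f → BSVY.IsWeakDeriv k f g →
            BSVY.bsvyFunctional k p q γ υ f ≤ ENNReal.ofReal C * BSVY.weightedEnergy p υ g,
        ∃ β ∈ BSVY.admissibleBeta p, ∃ C : ℝ, 0 < C ∧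
          ∀ α ∈ ({0, 1 / 3, 2 / 3} : Set ℝ),
            ∀ f g : ℝ → ℝ, BSVY.MemHomSobolev k p υ f → BSVY.IsWeakDeriv k f g →
              BSVY.dyadicFunctional k p β α υ f ≤
                ENNReal.ofReal C * BSVY.weightedEnergy p υ g] := by
  tfae_have 1 → 2 := fun h => by
    -- With γ = q the level set has b = 1, matching the quadratic heaviness condition; β = 2 plays
    -- the same role in the dyadic case.
    refine ⟨q, ?_, h.bsvyFunctional_le hk hp hq⟩
    unfold BSVY.admissibleGamma
    split_ifs
    · exact Or.inr hq
    · exact hq.ne'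
  tfae_have 2 → 1 := fun ⟨γ, _, C, _, h⟩ =>
    BSVY.isAp_of_exists_testAvgBound hp hυ0 hυ (BSVY.testAvgBound_of_bsvy hk hp hq hυ h)
  tfae_have 1 → 3 := fun h => by
    obtain ⟨C, hC, hb⟩ := h.dyadicFunctional_le hk hp
    refine ⟨2, ?_, C, hC, fun α _ => hb α⟩
    unfold BSVY.admissibleBeta
    split_ifs
    · exact Or.inr (Set.mem_Ioi.2 one_lt_two)
    · exact (by norm_num : (2 : ℝ) ≠ 1)
  tfae_have 3 → 1 := fun ⟨β, _, C, _, h⟩ =>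
    BSVY.isAp_of_exists_testAvgBound hp hυ0 hυ (BSVY.testAvgBound_of_dyadic hk hp hυ h)
  tfae_finish
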